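/- Let $\mathcal L:\mathbb R^d\to\mathbb R$ be differentiable, $L$-Lipschitz-smooth and $\mu$-strongly convex, i.e. for all $\theta,\theta'$, $$\tfrac{\mu}{2}\|\theta-\theta'\|^2\le \mathcal L(\theta')-\mathcal L(\theta)-\langle\nabla\mathcal L(\theta),\theta'-\theta\rangle\le \tfrac{L}{2}\|\theta-\theta'\|^2,\qquad \mu>0,$$ with minimizer $\theta^\star$. Let $0<\eta<1/2$ and let $\mathcal D_{\mathcal I}(\theta)$ (true gradients) and $\mathcal D_{\mathcal O}(\theta)$ (corruptions, arbitrary) be probability laws on $\mathbb R^d$ depending measurably on $\theta$. For $\widetilde G(\theta)\sim\mathcal D_{\mathcal I}(\theta)$ put $\varepsilon_\theta=\widetilde G(\theta)-\nabla\mathcal L(\theta)$ and assume: * $\mathbb E\,\varepsilon_\theta=0$, and the law of $\varepsilon_\theta$ is a mixture $w\nu_{\theta,1}+(1-w)\nu_{\theta,2}$ of probability measures, $w\in(0,1]$, where $\nu_{\theta,1}$ has a Lebesgue density $h_\theta$ with $\inf_{\|\omega\|\le R}h_\theta(\omega)>\varkappa(R)>0$ for all $R>0$, with $w$ and $\varkappa$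 independent of $\theta$; * for some $q\ge2$ and $A_q,B_q>0$: $\mathbb E[\|\varepsilon_\theta\|^q]^{1/q}\le A_q\|\theta-\theta^\star\|+B_q$ for all $\theta$. Let $p=1-\eta$, let $\tau_\theta$ be the $p$-quantile of $\|\widetilde G(\theta)\|$, and assume $$\kappa:=(1-\eta)p\mu-\eta L-(1-p)^{-1/q}A_q\bigl(1-p(1-\eta)\bigr)>0,$$ $$0<\beta<\frac14\,\frac{\kappa}{\mu^2+6L^2+16\eta^{-2/q}A_q^2},\qquad \beta\le\eta^{2-2/q}/\kappa .$$ A QC-SGD step from $\theta$ with observed gradient $G$ is $\theta\mapsto\theta-\min(1,\tau_\theta/\|G\|)\,\beta\,G$. Let $P$ be the transition kernel of the Markov chain making such steps with $G$ drawn from $\eta\,\mathcal D_{\mathcal O}(\theta)+(1-\eta)\,\mathcal D_{\mathcal I}(\theta)$. Fix $\theta_0\in\mathbb R^d$. Consider a probability measure $\pi$ with $\pi P=\pi$ and constants $0<M<\infty$, $0<\rho<1$ such that for all integers $t\ge0$, in total variation distance $d_{TV}(\nu_1,\nu_2)=\sup_A|\nu_1(A)-\nu_2(A)|$, $$d_{TV}(\delta_{\theta_0}P^t,\pi)\le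 M\rho^t\bigl(1+\|\theta_0-\theta^\star\|^2\bigr).\qquad(\ast)$$ (a) If $\tau_\theta$ is bounded away from $0$ on every bounded set of $\theta$, then $P$ has a unique invariant probability measure $\pi$, and $M,\rho$ satisfying $(\ast)$ exist. (b) Let $\pi,M,\rho$ be any such objects satisfying $(\ast)$. Let $\delta>0$ and let $N\ge1$ and $T\ge0$ be integers with $$N\ge16\log(1/\delta),\qquad T\ge N\left\lceil\frac{\log\bigl(15M(1+\|\theta_0-\theta^\star\|^2)\bigr)}{\log(1/\rho)}\right\rceil$$ (where a negative ceiling is replaced by $0$). Run $N$ iterates $\theta^{(1)},\dots,\theta^{(N)}$ from the common point $\theta_0$ for $T$ steps in total: at time $t=0,\dots,T-1$ only the iterate $n$ with $t\equiv n-1\bmod N$ makes a QC-SGD step. Given the gradients which that iterate has observed before, its new gradient has law $\eta\,\mathcal D_{\mathcal O}(\theta^{(n)}_t)+(1-\eta)\,\mathcal D_{\mathcal I}(\theta^{(n)}_t)$, and the gradient samples used by the $N$ iterates are independent. Let $r^{(i)}$ be the vector of the distances $\|\theta_T^{(i)}-\theta_T^{(j)}\|$, $1\le j\le N$, sorted in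 non-decreasing order, and let $\widehat\theta=\theta_T^{(\widehat i)}$, where $\widehat i$ minimizes $r^{(i)}_{\lceil N/2\rceil}$ over $i$, ties being broken arbitrarily. Then with probability at least $1-\delta$, $$\|\widehat\theta-\theta^\star\|\le\frac{27\,\eta^{1-1/q}B_q}{\kappa}.$$ (A fortiori the bound holds with $B_q$ replaced by $\overline B_q=A_qD+B_q$, for any $D\ge0$.) -/

import Mathlib

open MeasureTheory ProbabilityTheory
open scoped RealInnerProductSpace

namespace QCSGD

/-- The parameter space `ℝ^d` with its Euclidean norm. -/
abbrev Param (d : ℕ) : Type := EuclideanSpace ℝ (Fin d)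

/-! ### Objective -/

/-- `ℒ` is differentiable and `L`-Lipschitz-smooth. -/
def LipschitzSmooth {d : ℕ} (ℒ : Param d → ℝ) (L : ℝ) : Prop :=
  Differentiable ℝ ℒ ∧ ∀ θ θ' : Param d,
    ℒ θ' ≤ ℒ θ + ⟪gradient ℒ θ, θ' - θ⟫ + L / 2 * ‖θ - θ'‖ ^ 2

/-- `ℒ` is differentiable and `μ`-strongly convex. -/
def StronglyConvex {d : ℕ} (ℒ : Param d → ℝ) (μ : ℝ) : Prop :=
  Differentiable ℝ ℒ ∧ 0 < μ ∧ ∀ θ θ' : Param d,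
    ℒ θ + ⟪gradient ℒ θ, θ' - θ⟫ + μ / 2 * ‖θ - θ'‖ ^ 2 ≤ ℒ θ'

/-! ### Gradient distributions -/

/-- The law of the noise `ε_θ = G̃(θ) - ∇ℒ(θ)`, where `G̃(θ) ∼ DI θ`. -/
noncomputable def noiseLaw {d : ℕ} (ℒ : Param d → ℝ) (DI : Kernel (Param d) (Param d))
    (θ : Param d) : Measure (Param d) :=
  (DI θ).map (fun g => g - gradient ℒ θ)

/-- The noise is centered, and its law is a mixture `w ν_{θ,1} + (1 - w) ν_{θ,2}` of two
probability measures with `w > 0`, where `ν_{θ,1}` has a Lebesgue density whose infimum over each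
ball of radius `R` centered at `0` exceeds some `ϰ(R) > 0`; `w` and `ϰ` do not depend on `θ`. -/
def CenteredDiffuseNoise {d : ℕ} (ℒ : Param d → ℝ) (DI : Kernel (Param d) (Param d)) : Prop :=
  (∀ θ, Integrable (fun ε => ε) (noiseLaw ℒ DI θ) ∧ ∫ ε, ε ∂(noiseLaw ℒ DI θ) = 0) ∧
  ∃ (w : ℝ) (ϰ : ℝ → ℝ), 0 < w ∧ w ≤ 1 ∧ (∀ R, 0 < R → 0 < ϰ R) ∧
    ∀ θ, ∃ (ν₁ ν₂ : Measure (Param d)) (h : Param d → ENNReal),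
      IsProbabilityMeasure ν₁ ∧ IsProbabilityMeasure ν₂ ∧
      noiseLaw ℒ DI θ = ENNReal.ofReal w • ν₁ + ENNReal.ofReal (1 - w) • ν₂ ∧
      Measurable h ∧ ν₁ = (volume : Measure (Param d)).withDensity h ∧
      ∀ R, 0 < R → ENNReal.ofReal (ϰ R) < ⨅ ω ∈ Metric.closedBall (0 : Param d) R, h ω

/-- `(𝔼 ‖ε_θ‖^q)^{1/q} ≤ A ‖θ - θ⋆‖ + B` for all `θ`. -/
def NoiseMomentBound {d : ℕ} (ℒ : Param d → ℝ) (DI : Kernel (Param d) (Param d))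
    (θs : Param d) (q A B : ℝ) : Prop :=
  ∀ θ, eLpNorm (fun ε => ε) (ENNReal.ofReal q) (noiseLaw ℒ DI θ)
    ≤ ENNReal.ofReal (A * ‖θ - θs‖ + B)

/-- Law of an observed gradient at `θ`: with probability `η` it is drawn from the corrupted
law `DO θ`, otherwise from the true law `DI θ`. -/
noncomputable def corruptedGradient {d : ℕ} (η : ℝ) (DO DI : Kernel (Param d) (Param d)) :
    Kernel (Param d) (Param d) where
  toFun θ := ENNReal.ofReal η • DO θ + ENNReal.ofReal (1 - η) • DI θ
  measurable' := by
    refine Measure.measurable_of_measurable_coe _ fun s hs => ?_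
    simp only [Measure.add_apply, Measure.smul_apply, smul_eq_mul]
    exact ((DO.measurable_coe hs).const_mul _).add ((DI.measurable_coe hs).const_mul _)

/-! ### The iteration -/

/-- The `p`-quantile `inf {s : p ≤ F(s)}` of a law on `ℝ` with distribution function `F`. -/
noncomputable def quantile (ν : Measure ℝ) (p : ℝ) : ℝ :=
  sInf {s : ℝ | p ≤ cdf ν s}

/-- The clipping threshold `τ_θ`: the `p`-quantile of the norm of a true gradient sample. -/
noncomputable def threshold {d : ℕ} (DI : Kernel (Param d) (Param d)) (p : ℝ) (θ : Param d) : ℝ :=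
  quantile ((DI θ).map (fun g => ‖g‖)) p

/-- One step from `θ` with the observed gradient `g`: `θ - α β g`, `α = min (1, τ_θ / ‖g‖)`
(at `g = 0` the value of `α` is irrelevant). -/
noncomputable def qcStep {d : ℕ} (DI : Kernel (Param d) (Param d)) (β p : ℝ) (θ g : Param d) :
    Param d :=
  θ - (min 1 (threshold DI p θ / ‖g‖) * β) • g

theorem measurable_threshold {d : ℕ} (DI : Kernel (Param d) (Param d)) [IsMarkovKernel DI]
    (p : ℝ) : Measurable (threshold DI p) := by
  have hprob : ∀ θ, IsProbabilityMeasure ((DI θ).map (fun g => ‖g‖)) := fun θ =>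
    Measure.isProbabilityMeasure_map (by fun_prop)
  have hF : ∀ s : ℝ, Measurable fun θ => cdf ((DI θ).map (fun g => ‖g‖)) s := by
    intro s
    have : (fun θ => cdf ((DI θ).map (fun g => ‖g‖)) s)
        = fun θ => (DI θ ((fun g => ‖g‖) ⁻¹' Set.Iic s)).toReal := by
      funext θ
      rw [cdf_eq_real, Measure.real, Measure.map_apply (by fun_prop) measurableSet_Iic]
    rw [this]
    exact (DI.measurable_coe (measurableSet_Iic.preimage (by fun_prop))).ennreal_toReal
  have hneg : ∀ θ, ∀ s : ℝ, s < 0 → cdf ((DI θ).map (fun g => ‖g‖)) s = 0 := by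
    intro θ s hs
    rw [cdf_eq_real, Measure.real, Measure.map_apply (by fun_prop) measurableSet_Iic]
    have : (fun g : Param d => ‖g‖) ⁻¹' Set.Iic s = ∅ := by
      ext g
      simp only [Set.mem_preimage, Set.mem_Iic, Set.mem_empty_iff_false, iff_false, not_le]
      exact hs.trans_le (norm_nonneg g)
    simp [this]
  by_cases hp : p ≤ 0
  · have : threshold DI p = fun _ => sInf (Set.univ : Set ℝ) := by
      funext θ
      unfold threshold quantile
      congr 1
      ext s
      simpa using hp.trans (cdf_nonneg _ s)
    rw [this]
    exact measurable_const
  push Not at hp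
  refine measurable_of_Iic fun s => ?_
  have hset : threshold DI p ⁻¹' Set.Iic s
      = {θ | p ≤ cdf ((DI θ).map (fun g => ‖g‖)) s} ∪
        ({θ | ∀ n : ℕ, cdf ((DI θ).map (fun g => ‖g‖)) n < p} ∩ {_θ | 0 ≤ s}) := by
    ext θ
    simp only [Set.mem_preimage, Set.mem_Iic, Set.mem_union, Set.mem_inter_iff, Set.mem_ofPred_eq]
    set F := cdf ((DI θ).map (fun g => ‖g‖)) with hFdef
    have hbdd : BddBelow {s : ℝ | p ≤ F s} := by
      refine ⟨0, fun t ht => ?_⟩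
      by_contra hlt
      push Not at hlt
      have h1 : p ≤ F t := ht
      rw [hFdef, hneg θ t hlt] at h1
      exact absurd h1 (not_le.2 hp)
    by_cases hemp : ∀ n : ℕ, F n < p
    · have hS : {s : ℝ | p ≤ F s} = ∅ := by
        ext t
        simp only [Set.mem_ofPred_eq, Set.mem_empty_iff_false, iff_false, not_le]
        obtain ⟨n, hn⟩ := exists_nat_ge t
        exact (F.mono hn).trans_lt (hemp n)
      have hτ : threshold DI p θ = 0 := by
        unfold threshold quantile
        rw [← hFdef, hS, Real.sInf_empty]
      have hs : ¬ p ≤ F s := by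
        intro h
        have : s ∈ {s : ℝ | p ≤ F s} := h
        rw [hS] at this
        exact this
      rw [hτ]
      tauto
    · have hne : {s : ℝ | p ≤ F s}.Nonempty := by
        push Not at hemp
        obtain ⟨n, hn⟩ := hemp
        exact ⟨n, hn⟩
      have hiff : threshold DI p θ ≤ s ↔ p ≤ F s := by
        constructor
        · intro h
          have hgt : ∀ t ∈ Set.Ioi s, p ≤ F t := by
            intro t ht
            obtain ⟨u, hu, hut⟩ := exists_lt_of_csInf_lt hne (lt_of_le_of_lt h ht)
            exact le_trans hu (F.mono hut.le)
          have hc := F.right_continuous s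
          have hc' : Filter.Tendsto F (nhdsWithin s (Set.Ioi s)) (nhds (F s)) :=
            (hc.mono Set.Ioi_subset_Ici_self).tendsto
          exact ge_of_tendsto hc' (Filter.eventually_of_mem self_mem_nhdsWithin hgt)
        · intro h
          exact csInf_le hbdd h
      rw [hiff]
      tauto
  rw [hset]
  refine (measurableSet_le measurable_const (hF s)).union (MeasurableSet.inter ?_ ?_)
  · rw [Set.ofPred_forall]
    exact MeasurableSet.iInter fun n => measurableSet_lt (hF n) measurable_const
  · exact MeasurableSet.const _

theorem measurable_qcStep {d : ℕ} (DI : Kernel (Param d) (Param d)) [IsMarkovKernel DI]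
    (β p : ℝ) : Measurable fun z : Param d × Param d => qcStep DI β p z.1 z.2 := by
  have h : Measurable fun z : Param d × Param d => threshold DI p z.1 :=
    (measurable_threshold DI p).comp measurable_fst
  have hc : Measurable fun z : Param d × Param d => min 1 (threshold DI p z.1 / ‖z.2‖) * β :=
    (measurable_const.min (h.div measurable_snd.norm)).mul_const β
  have hs : Measurable fun z : Param d × Param d =>
      (min 1 (threshold DI p z.1 / ‖z.2‖) * β) • z.2 := hc.smul measurable_snd
  exact measurable_fst.sub hs

/-- The transition kernel `P_{β,p}` of the Markov chain: a step with an observed gradient drawn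
from the law of the (possibly corrupted) gradient at the current point. -/
noncomputable def qcKernel {d : ℕ} (η : ℝ) (DO DI : Kernel (Param d) (Param d))
    [IsMarkovKernel DO] [IsMarkovKernel DI] (β p : ℝ) : Kernel (Param d) (Param d) where
  toFun θ := (corruptedGradient η DO DI θ).map (qcStep DI β p θ)
  measurable' := by
    have : IsFiniteKernel (corruptedGradient η DO DI) := by
      refine ⟨⟨ENNReal.ofReal η + ENNReal.ofReal (1 - η), by simp, fun θ => ?_⟩⟩
      have : corruptedGradient η DO DI θ
          = ENNReal.ofReal η • DO θ + ENNReal.ofReal (1 - η) • DI θ := rfl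
      simp [this]
    have h : (fun θ => (corruptedGradient η DO DI θ).map (qcStep DI β p θ))
        = fun θ => ((Kernel.id ×ₖ corruptedGradient η DO DI).map
            (fun z : Param d × Param d => qcStep DI β p z.1 z.2)) θ := by
      funext θ
      rw [Kernel.map_apply _ (measurable_qcStep DI β p), Kernel.prod_apply, Kernel.id_apply,
        Measure.dirac_prod, Measure.map_map (measurable_qcStep DI β p) measurable_prodMk_left]
      rfl
    rw [h]
    exact Kernel.measurable _

/-- The law `ν P^t` of the chain after `t` steps from the initial law `ν`. -/
noncomputable def lawAfter {d : ℕ} (P : Kernel (Param d) (Param d)) (ν : Measure (Param d))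
    (t : ℕ) : Measure (Param d) :=
  (fun m : Measure (Param d) => m.bind P)^[t] ν

/-- Total variation distance `sup_A |ν₁(A) - ν₂(A)|` between probability measures. -/
noncomputable def tvDist {d : ℕ} (ν₁ ν₂ : Measure (Param d)) : ℝ :=
  ⨆ A : {A : Set (Param d) // MeasurableSet A}, |ν₁.real A - ν₂.real A|

/-- The chain started at `θ₀` converges geometrically, with constants `M` and `ρ`, to the
invariant probability measure `π`. -/
def GeometricConvergence {d : ℕ} (P : Kernel (Param d) (Param d)) (θs θ₀ : Param d)
    (π : Measure (Param d)) (M ρ : ℝ) : Prop :=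
  IsProbabilityMeasure π ∧ Kernel.Invariant P π ∧ 0 < M ∧ 0 < ρ ∧ ρ < 1 ∧
    ∀ t : ℕ, tvDist (lawAfter P (Measure.dirac θ₀) t) π ≤ M * ρ ^ t * (1 + ‖θ₀ - θs‖ ^ 2)

/-- `κ = (1 - η) p μ - η L - (1 - p)^{-1/q} A (1 - p (1 - η))`. -/
noncomputable def kappa (η p μ L q A : ℝ) : ℝ :=
  (1 - η) * p * μ - η * L - (1 - p) ^ (-(1 / q)) * A * (1 - p * (1 - η))

/-! ### Cycling iterates and their aggregation -/

/-- `cyclicIterates N step θ₀ g t n` is the `n`-th of `N` iterates (numbered from `0`) at time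
`t`: all start from `θ₀`, and the observed gradient `g t` at time `t` serves to update the
iterate `n ≡ t mod N` only. -/
def cyclicIterates {d : ℕ} (N : ℕ) (step : Param d → Param d → Param d) (θ₀ : Param d)
    (g : ℕ → Param d) : ℕ → Fin N → Param d
  | 0, _ => θ₀
  | t + 1, n =>
    if t % N = (n : ℕ) then step (cyclicIterates N step θ₀ g t n) (g t)
    else cyclicIterates N step θ₀ g t n

/-- The index of the iterate that is updated at time `t`. -/
def activeRun (N : ℕ) (hN : 0 < N) (t : ℕ) : Fin N := ⟨t % N, Nat.mod_lt t hN⟩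

/-- The information available to the run that is updated at time `t`: the gradients it has
observed before `t`. -/
abbrev runPast {d : ℕ} {Ω : Type*} (N : ℕ) (g : ℕ → Ω → Param d) (t : ℕ) : MeasurableSpace Ω :=
  ⨆ s ∈ {s : ℕ | s < t ∧ s % N = t % N}, MeasurableSpace.comap (g s) inferInstance

/-- `g t` is the gradient observed at time `t` by the run that is updated then. Given the past of
the run, it is a corrupted gradient sample at the run's current iterate (drawn from `DO` with
probability `η`, from `DI` otherwise), and the gradient samples of the `N` runs are independent. -/
structure IsCorruptedStream {d : ℕ} {Ω : Type*} [MeasurableSpace Ω] (Pr : Measure Ω)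
    (η : ℝ) (DO DI : Kernel (Param d) (Param d)) (β p : ℝ) (θ₀ : Param d)
    (N : ℕ) (hN : 0 < N) (g : ℕ → Ω → Param d) : Prop where
  measurable : ∀ t, Measurable (g t)
  law : ∀ t (A : Set (Param d)), MeasurableSet A →
    Pr⟦g t ⁻¹' A | runPast N g t⟧ =ᵐ[Pr] fun ω =>
      (corruptedGradient η DO DI
        (cyclicIterates N (qcStep DI β p) θ₀ (fun s => g s ω) t (activeRun N hN t))).real A
  indep : iIndepFun (fun (n : Fin N) (ω : Ω) (k : ℕ) => g (n + k * N) ω) Pr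

/-- `r^{(j)}_{⌈N/2⌉}`: the `⌈N/2⌉`-th smallest (counted from `1`) of the distances
`‖x j - x i‖`, `i = 1, …, N`, repetitions and `i = j` included. -/
noncomputable def medianDist {d N : ℕ} (hN : 0 < N) (x : Fin N → Param d) (j : Fin N) : ℝ :=
  (fun i => ‖x j - x i‖) (Tuple.sort (fun i => ‖x j - x i‖) ⟨(N - 1) / 2, by omega⟩)

/-- `θ̂` is an output of the aggregation: a point `x i` for which `medianDist` is minimal.
Ties may be broken in any way. -/
def IsAggregate {d N : ℕ} (hN : 0 < N) (x : Fin N → Param d) (θhat : Param d) : Prop :=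
  ∃ i : Fin N, (∀ j : Fin N, medianDist hN x i ≤ medianDist hN x j) ∧ θhat = x i

end QCSGD

open QCSGD

namespace QCSGD

/-! ### The objective -/

section Objective

variable {d : ℕ} {ℒ : Param d → ℝ} {L μ : ℝ} {θs : Param d}

/-! Everything rests on the Lyapunov function `V θ = ‖θ - θs‖ ^ 2`. Clipping at `τ_θ` limits the
damage of a corrupted gradient to a displacement `β τ_θ`, and Markov's inequality bounds `τ_θ` by
the gradient norm plus `η^(-1/q)` times the noise level. A true gradient is left unclipped with
probability at least `p`, and then strong convexity pulls towards `θs`; Hölder controls the noise on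
the clipped event. The first-order terms add up exactly to `-κ V` plus a multiple of `√V`, and the
step-size conditions absorb the rest (`drift_arith`, `lintegral_qcKernel_le`). With `a = η^(1-1/q) B
/ κ`, the result is `E V(θ') ≤ (1 - γ) V(θ) + b`, where `γ = 9βκ/10` and `b = 10βκ a²`.

High-probability bound: iterating the drift, the limit law has tail at most `b / γ / (9a)² =
100/729` beyond radius `9a`. Each iterate has made at least `T / N` steps, so its own tail is larger
by at most `1/15`, and is below `21/100`. The iterates are independent, so by Hoeffding more than
half of them are good outside an event of probability `exp(-N/16) ≤ δ` (`measure_half_le_card_le`).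
The triangle inequality then puts the aggregate within `3 · 9a = 27a`
(`IsAggregate.norm_sub_le_three_mul`).

Existence and uniqueness of the limit: this is Harris' theorem in the oscillation-seminorm form.
Where thresholds are bounded below, small gradients are not clipped, so the noise density spreads
one step over a ball of fixed radius. Chaining such steps minorizes a power of the kernel on a large
ball (`exists_minorization`). Together with the drift this contracts weighted oscillations
(`exists_oscBound_contraction`), so the laws of the chain are Cauchy in total variation, hence
convergent (`exists_limit_measure`). -/

theorem gradient_eq_zero_of_forall_le (hθs : ∀ θ, ℒ θs ≤ ℒ θ) : gradient ℒ θs = 0 := by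
  have h : IsLocalMin ℒ θs := Filter.Eventually.of_forall hθs
  rw [gradient, h.fderiv_eq_zero, map_zero]

/-- One gradient step of length `1/L` cannot go below the minimum, so `‖∇ℒ θ‖² / (2L) ≤ ℒ θ - ℒ θs ≤
(L/2) ‖θ - θs‖²`. Only the quadratic upper bound is needed, not the Lipschitz property of the
gradient. -/
theorem norm_gradient_le (hsmooth : LipschitzSmooth ℒ L) (hconv : StronglyConvex ℒ μ)
    (hθs : ∀ θ, ℒ θs ≤ ℒ θ) (θ : Param d) : ‖gradient ℒ θ‖ ≤ L * ‖θ - θs‖ := by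
  have h0 := gradient_eq_zero_of_forall_le hθs
  by_cases hθ : θ = θs
  · simp [hθ, h0]
  have hΔ : 0 < ‖θ - θs‖ := norm_pos_iff.2 (sub_ne_zero.2 hθ)
  have h1 := hsmooth.2 θs θ
  have h2 := hconv.2.2 θs θ
  rw [h0, inner_zero_left, norm_sub_rev] at h1 h2
  have hμ := hconv.2.1
  -- Positivity of `L` comes from comparing the lower and upper quadratic bounds at a point other
  -- than `θs`.
  have hL : 0 < L := by
    by_contra hL
    have : 0 < μ / 2 * ‖θ - θs‖ ^ 2 := by positivity
    nlinarith [sq_nonneg ‖θ - θs‖]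
  have h3 := hsmooth.2 θ (θ - L⁻¹ • gradient ℒ θ)
  have h4 := hθs (θ - L⁻¹ • gradient ℒ θ)
  have e1 : θ - L⁻¹ • gradient ℒ θ - θ = -(L⁻¹ • gradient ℒ θ) := by abel
  have e2 : θ - (θ - L⁻¹ • gradient ℒ θ) = L⁻¹ • gradient ℒ θ := by abel
  rw [e1, e2, inner_neg_right, real_inner_smul_right, real_inner_self_eq_norm_sq, norm_smul,
    Real.norm_of_nonneg (by positivity)] at h3
  have e3 : L / 2 * (L⁻¹ * ‖gradient ℒ θ‖) ^ 2 = L⁻¹ * ‖gradient ℒ θ‖ ^ 2 / 2 := by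
    field_simp
  rw [e3] at h3
  have h5 : L⁻¹ * ‖gradient ℒ θ‖ ^ 2 ≤ L * ‖θ - θs‖ ^ 2 := by linarith
  have h6 : ‖gradient ℒ θ‖ ^ 2 ≤ (L * ‖θ - θs‖) ^ 2 := by
    have := mul_le_mul_of_nonneg_left h5 hL.le
    rwa [← mul_assoc, mul_inv_cancel₀ hL.ne', one_mul, ← mul_assoc, ← sq, ← mul_pow] at this
  exact le_of_sq_le_sq h6 (by positivity)

/-- Add the strong convexity inequalities from `θ` to `θs` and from `θs` to `θ`; each contributes
`μ/2`. -/
theorem le_inner_gradient (hconv : StronglyConvex ℒ μ) (hθs : ∀ θ, ℒ θs ≤ ℒ θ) (θ : Param d) :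
    μ * ‖θ - θs‖ ^ 2 ≤ ⟪θ - θs, gradient ℒ θ⟫ := by
  have h1 := hconv.2.2 θ θs
  have h2 := hconv.2.2 θs θ
  rw [gradient_eq_zero_of_forall_le hθs, inner_zero_left, norm_sub_rev] at h2
  rw [← neg_sub θ θs, inner_neg_right, real_inner_comm] at h1
  linarith

end Objective

/-! ### Quantiles -/

section Quantile

variable {ν : Measure ℝ} {p : ℝ}

theorem quantile_set_nonempty (ν : Measure ℝ) (hp : p < 1) : {s : ℝ | p ≤ cdf ν s}.Nonempty := by
  obtain ⟨s, hs⟩ := ((tendsto_cdf_atTop ν).eventually (eventually_ge_nhds hp)).exists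
  exact ⟨s, hs⟩

theorem quantile_set_bddBelow (ν : Measure ℝ) (hp : 0 < p) : BddBelow {s : ℝ | p ≤ cdf ν s} := by
  obtain ⟨s, hs⟩ := ((tendsto_cdf_atBot ν).eventually (eventually_lt_nhds hp)).exists
  refine ⟨s, fun t ht => ?_⟩
  by_contra hlt
  exact absurd (le_trans ht (monotone_cdf ν (not_le.1 hlt).le)) (not_le.2 hs)

theorem cdf_lt_of_lt_quantile (hp : 0 < p) {s : ℝ} (hs : s < quantile ν p) : cdf ν s < p := by
  by_contra h
  exact absurd (csInf_le (quantile_set_bddBelow ν hp) (not_lt.1 h)) (not_le.2 hs)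

theorem le_cdf_quantile (ν : Measure ℝ) (hp : p < 1) : p ≤ cdf ν (quantile ν p) := by
  have hgt : ∀ t ∈ Set.Ioi (quantile ν p), p ≤ cdf ν t := by
    intro t ht
    obtain ⟨u, hu, hut⟩ := exists_lt_of_csInf_lt (quantile_set_nonempty ν hp) ht
    exact le_trans hu (monotone_cdf ν hut.le)
  have hc := (cdf ν).right_continuous (quantile ν p)
  exact ge_of_tendsto (hc.mono Set.Ioi_subset_Ici_self).tendsto
    (Filter.eventually_of_mem self_mem_nhdsWithin hgt)

variable {d : ℕ} (DI : Kernel (Param d) (Param d)) [IsMarkovKernel DI]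

theorem cdf_map_norm (θ : Param d) (s : ℝ) :
    cdf ((DI θ).map (fun g => ‖g‖)) s = (DI θ).real {g | ‖g‖ ≤ s} := by
  have : IsProbabilityMeasure ((DI θ).map (fun g => ‖g‖)) :=
    Measure.isProbabilityMeasure_map (by fun_prop)
  rw [cdf_eq_real, map_measureReal_apply (by fun_prop) measurableSet_Iic]
  rfl

theorem le_measure_norm_le_threshold (hp : p < 1) (θ : Param d) :
    p ≤ (DI θ).real {g | ‖g‖ ≤ threshold DI p θ} := by
  rw [← cdf_map_norm]
  exact le_cdf_quantile _ hp

theorem measure_norm_le_lt_of_lt_threshold (hp : 0 < p) (θ : Param d) {s : ℝ}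
    (hs : s < threshold DI p θ) : (DI θ).real {g | ‖g‖ ≤ s} < p := by
  rw [← cdf_map_norm]
  exact cdf_lt_of_lt_quantile hp hs

theorem threshold_nonneg (hp0 : 0 < p) (hp : p < 1) (θ : Param d) : 0 ≤ threshold DI p θ := by
  by_contra h
  have h1 := le_measure_norm_le_threshold DI hp θ
  have : {g : Param d | ‖g‖ ≤ threshold DI p θ} = ∅ := by
    ext g
    simpa using (not_le.1 h).trans_le (norm_nonneg g)
  rw [this, measureReal_empty] at h1
  linarith

end Quantile

/-! ### Moments of the noise -/

section Moments

variable {d : ℕ} {ν : Measure (Param d)} {v : Param d} {q σ : ℝ}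

theorem memLp_of_eLpNorm_le (hmom : eLpNorm (fun g => g - v) (ENNReal.ofReal q) ν
    ≤ ENNReal.ofReal σ) : MemLp (fun g => g - v) (ENNReal.ofReal q) ν :=
  ⟨by fun_prop, hmom.trans_lt ENNReal.ofReal_lt_top⟩

variable [IsProbabilityMeasure ν]

theorem memLp_two_of_eLpNorm_le (hq : 2 ≤ q) (hmom : eLpNorm (fun g => g - v) (ENNReal.ofReal q) ν
    ≤ ENNReal.ofReal σ) : MemLp (fun g => g - v) 2 ν :=
  (memLp_of_eLpNorm_le hmom).mono_exponent (by
    rw [← ENNReal.ofReal_ofNat]; exact ENNReal.ofReal_le_ofReal hq)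

theorem integral_norm_sq_le (hq : 2 ≤ q) (hσ : 0 ≤ σ)
    (hmom : eLpNorm (fun g => g - v) (ENNReal.ofReal q) ν ≤ ENNReal.ofReal σ) :
    ∫ g, ‖g - v‖ ^ 2 ∂ν ≤ σ ^ 2 := by
  have h2 := memLp_two_of_eLpNorm_le hq hmom
  have hle : eLpNorm (fun g => g - v) 2 ν ≤ ENNReal.ofReal σ :=
    (eLpNorm_le_eLpNorm_of_exponent_le (by
      rw [← ENNReal.ofReal_ofNat]; exact ENNReal.ofReal_le_ofReal hq) (by fun_prop)).trans hmom
  rw [h2.eLpNorm_eq_integral_rpow_norm (by simp) (by simp)] at hle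
  have h3 := (ENNReal.ofReal_le_ofReal_iff hσ).1 hle
  simp only [ENNReal.toReal_ofNat, Real.rpow_ofNat] at h3
  have h0 : 0 ≤ ∫ g, ‖g - v‖ ^ 2 ∂ν := integral_nonneg fun _ => by positivity
  have h4 := pow_le_pow_left₀ (by positivity) h3 2
  rwa [← Real.rpow_natCast, ← Real.rpow_mul h0, show (2 : ℝ)⁻¹ * ((2 : ℕ) : ℝ) = 1 by norm_num,
    Real.rpow_one] at h4

/-- Hölder on the restricted measure. With `S` the clipped event this yields the factor `(1 - p)^(1
- 1/q)` in `κ`. -/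
theorem setIntegral_norm_le (hq : 2 ≤ q) (hσ : 0 ≤ σ)
    (hmom : eLpNorm (fun g => g - v) (ENNReal.ofReal q) ν ≤ ENNReal.ofReal σ)
    (S : Set (Param d)) : ∫ g in S, ‖g - v‖ ∂ν ≤ ν.real S ^ (1 - 1 / q) * σ := by
  have hq0 : 0 ≤ q := by linarith
  have h1 : (1 : ENNReal) ≤ ENNReal.ofReal q := by
    rw [← ENNReal.ofReal_one]; exact ENNReal.ofReal_le_ofReal (by linarith)
  have h2 := eLpNorm_le_eLpNorm_mul_rpow_measure_univ (μ := ν.restrict S)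
    (f := fun g : Param d => g - v) h1 (by fun_prop)
  have h3 : eLpNorm (fun g => g - v) 1 (ν.restrict S)
      ≤ ENNReal.ofReal σ * ν S ^ (1 - 1 / q) := by
    refine h2.trans ?_
    rw [ENNReal.toReal_ofReal hq0, Measure.restrict_apply_univ, ENNReal.toReal_one, div_one]
    gcongr
    exact (eLpNorm_mono_measure _ Measure.restrict_le_self).trans hmom
  have he : 0 ≤ 1 - 1 / q := by
    have : 1 / q ≤ 1 := (div_le_one (by linarith)).2 (by linarith)
    linarith
  rw [eLpNorm_one_eq_lintegral_enorm] at h3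
  rw [integral_norm_eq_lintegral_enorm (by fun_prop)]
  have h4 := ENNReal.toReal_mono (ENNReal.mul_ne_top ENNReal.ofReal_ne_top
    (ENNReal.rpow_ne_top_of_nonneg he (measure_ne_top _ _))) h3
  rwa [ENNReal.toReal_mul, ENNReal.toReal_ofReal hσ, ← ENNReal.toReal_rpow, mul_comm] at h4

/-- Markov's inequality for the `q`-th power, solved for the radius: a level exceeded with
probability at least `η` cannot be large. -/
theorem le_of_le_measure_norm_ge (hq : 2 ≤ q) (hσ : 0 ≤ σ)
    (hmom : eLpNorm (fun g => g - v) (ENNReal.ofReal q) ν ≤ ENNReal.ofReal σ)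
    {η r : ℝ} (hη : 0 < η) (hr : 0 ≤ r) (h : η ≤ ν.real {g | r ≤ ‖g - v‖}) :
    r ≤ η ^ (-(1 / q)) * σ := by
  have hq0 : 0 < q := by linarith
  have h1 := mul_meas_ge_le_pow_eLpNorm (p := ENNReal.ofReal q) ν (by simpa using hq0)
    ENNReal.ofReal_ne_top (f := fun g : Param d => g - v) (by fun_prop) (ENNReal.ofReal r ^ q)
  rw [ENNReal.toReal_ofReal hq0.le] at h1
  have hset : {g : Param d | ENNReal.ofReal r ^ q ≤ ‖g - v‖ₑ ^ q} = {g | r ≤ ‖g - v‖} := by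
    ext g
    simp only [Set.mem_ofPred_eq]
    rw [ENNReal.rpow_le_rpow_iff hq0, ← ofReal_norm,
      ENNReal.ofReal_le_ofReal_iff (norm_nonneg _)]
  rw [hset] at h1
  have h2 : ENNReal.ofReal (r ^ q * η) ≤ ENNReal.ofReal (σ ^ q) := by
    rw [ENNReal.ofReal_mul (by positivity), ← ENNReal.ofReal_rpow_of_nonneg hr hq0.le,
      ← ENNReal.ofReal_rpow_of_nonneg hσ hq0.le]
    refine le_trans ?_ (h1.trans ?_)
    · gcongr
      rw [← ofReal_measureReal]
      exact ENNReal.ofReal_le_ofReal h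
    · gcongr
  have h3 := (ENNReal.ofReal_le_ofReal_iff (by positivity)).1 h2
  have h4 := Real.rpow_le_rpow (by positivity) h3 (by positivity : 0 ≤ 1 / q)
  rw [Real.mul_rpow (by positivity) hη.le, ← Real.rpow_mul hr, ← Real.rpow_mul hσ,
    mul_one_div_cancel hq0.ne', Real.rpow_one, Real.rpow_one] at h4
  rw [Real.rpow_neg hη.le, inv_mul_eq_div, le_div_iff₀ (by positivity)]
  exact h4

end Moments

theorem threshold_le {d : ℕ} (DI : Kernel (Param d) (Param d)) [IsMarkovKernel DI]
    {p q σ : ℝ} {v : Param d} (hp0 : 0 < p) (hp : p < 1) (θ : Param d) (hq : 2 ≤ q) (hσ : 0 ≤ σ)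
    (hmom : eLpNorm (fun g => g - v) (ENNReal.ofReal q) (DI θ) ≤ ENNReal.ofReal σ) :
    threshold DI p θ ≤ ‖v‖ + (1 - p) ^ (-(1 / q)) * σ := by
  -- Levels `s` strictly below the quantile are used because only there is `‖g‖ > s` known to have
  -- probability above `1 - p`.
  refine le_of_forall_lt_imp_le_of_dense fun s hs => ?_
  have h1 := measure_norm_le_lt_of_lt_threshold DI hp0 θ hs
  have hpos : 0 ≤ (1 - p) ^ (-(1 / q)) * σ := by
    have : 0 ≤ 1 - p := by linarith
    positivity
  by_cases hr : 0 ≤ s - ‖v‖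
  · have h2 : 1 - p ≤ (DI θ).real {g | s - ‖v‖ ≤ ‖g - v‖} := by
      have h3 : (DI θ).real {g | ‖g‖ ≤ s}ᶜ = 1 - (DI θ).real {g | ‖g‖ ≤ s} :=
        probReal_compl_eq_one_sub (measurableSet_le (by fun_prop) (by fun_prop))
      have h4 : (DI θ).real {g | ‖g‖ ≤ s}ᶜ ≤ (DI θ).real {g | s - ‖v‖ ≤ ‖g - v‖} := by
        refine measureReal_mono fun g hg => ?_
        have hg' : s < ‖g‖ := by simpa using hg
        have := norm_sub_norm_le g v
        simp only [Set.mem_ofPred_eq]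
        linarith
      linarith
    have := le_of_le_measure_norm_ge hq hσ hmom (by linarith) hr h2
    linarith
  · linarith [norm_nonneg v]

/-! ### The drift inequality -/

theorem norm_clip_le {d : ℕ} {τ : ℝ} (hτ : 0 ≤ τ) (g : Param d) :
    ‖min 1 (τ / ‖g‖) • g‖ ≤ τ := by
  rw [norm_smul, Real.norm_of_nonneg (le_min zero_le_one (by positivity))]
  by_cases hg : ‖g‖ = 0
  · simpa [hg] using hτ
  calc min 1 (τ / ‖g‖) * ‖g‖ ≤ τ / ‖g‖ * ‖g‖ := by gcongr; exact min_le_right _ _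
    _ = τ := div_mul_cancel₀ _ hg

theorem clip_eq_self {d : ℕ} {τ : ℝ} {g : Param d} (hg : ‖g‖ ≤ τ) :
    min 1 (τ / ‖g‖) • g = g := by
  by_cases h0 : g = 0
  · simp [h0]
  · rw [min_eq_left ((one_le_div (norm_pos_iff.2 h0)).2 hg), one_smul]

theorem norm_clip_le_norm {d : ℕ} {τ : ℝ} (hτ : 0 ≤ τ) (g : Param d) :
    ‖min 1 (τ / ‖g‖) • g‖ ≤ ‖g‖ := by
  rw [norm_smul, Real.norm_of_nonneg (le_min zero_le_one (by positivity))]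
  exact mul_le_of_le_one_left (norm_nonneg _) (min_le_left _ _)

theorem qcStep_eq {d : ℕ} (DI : Kernel (Param d) (Param d)) (β p : ℝ) (θ g : Param d) :
    qcStep DI β p θ g = θ - β • (min 1 (threshold DI p θ / ‖g‖) • g) := by
  rw [qcStep, smul_smul, mul_comm]

theorem norm_qcStep_sub_le {d : ℕ} (DI : Kernel (Param d) (Param d)) {β p : ℝ} (hβ : 0 ≤ β)
    (θs θ g : Param d) (hτ : 0 ≤ threshold DI p θ) :
    ‖qcStep DI β p θ g - θs‖ ≤ ‖θ - θs‖ + β * threshold DI p θ := by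
  rw [qcStep_eq, sub_right_comm]
  refine (norm_sub_le _ _).trans ?_
  rw [norm_smul, Real.norm_of_nonneg hβ]
  gcongr
  exact norm_clip_le hτ g

/-- Pointwise expansion of a step with a gradient `g`, clipped at level `τ`, in terms of the
deviation `g - v` from the true gradient `v`. -/
theorem norm_sub_smul_clip_sq_le {d : ℕ} {β μ L τ : ℝ} {Δ v g : Param d} (hβ : 0 ≤ β)
    (hτ : 0 ≤ τ) (hμ : 0 ≤ μ) (h1 : μ * ‖Δ‖ ^ 2 ≤ ⟪Δ, v⟫) (h2 : ‖v‖ ≤ L * ‖Δ‖) :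
    ‖Δ - β • (min 1 (τ / ‖g‖) • g)‖ ^ 2 ≤ ‖Δ‖ ^ 2
      - 2 * β * ({g : Param d | ‖g‖ ≤ τ}.indicator (fun _ => μ * ‖Δ‖ ^ 2) g + ⟪Δ, g - v⟫
        - ‖Δ‖ * {g : Param d | ‖g‖ ≤ τ}ᶜ.indicator (fun g => ‖g - v‖) g)
      + β ^ 2 * (L ^ 2 * ‖Δ‖ ^ 2 + 2 * ⟪v, g - v⟫ + ‖g - v‖ ^ 2) := by
  have hH : ‖min 1 (τ / ‖g‖) • g‖ ^ 2 ≤ L ^ 2 * ‖Δ‖ ^ 2 + 2 * ⟪v, g - v⟫ + ‖g - v‖ ^ 2 := by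
    have e : ‖g‖ ^ 2 = ‖v‖ ^ 2 + 2 * ⟪v, g - v⟫ + ‖g - v‖ ^ 2 := by
      rw [← norm_add_sq_real, add_sub_cancel]
    have := pow_le_pow_left₀ (norm_nonneg _) (norm_clip_le_norm hτ g) 2
    have := pow_le_pow_left₀ (norm_nonneg _) h2 2
    rw [mul_pow] at this
    linarith
  -- The linear term `⟪Δ, g - v⟫` is kept on clipped gradients too, so that it integrates to zero.
  -- Off the unclipped set, the pull `α ⟪Δ, v⟫` is nonnegative and is dropped, and replacing `α` by
  -- `1` in the noise term costs at most `‖Δ‖ ‖g - v‖`.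
  have hI : {g : Param d | ‖g‖ ≤ τ}.indicator (fun _ => μ * ‖Δ‖ ^ 2) g + ⟪Δ, g - v⟫
        - ‖Δ‖ * {g : Param d | ‖g‖ ≤ τ}ᶜ.indicator (fun g => ‖g - v‖) g
      ≤ ⟪Δ, min 1 (τ / ‖g‖) • g⟫ := by
    by_cases hg : ‖g‖ ≤ τ
    · have m1 : g ∈ {g : Param d | ‖g‖ ≤ τ} := hg
      rw [clip_eq_self hg, Set.indicator_of_mem m1,
        Set.indicator_of_notMem (Set.notMem_compl_iff.2 m1), inner_sub_right]
      linarith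
    · have m1 : g ∉ {g : Param d | ‖g‖ ≤ τ} := hg
      rw [Set.indicator_of_notMem m1, Set.indicator_of_mem (Set.mem_compl m1),
        real_inner_smul_right]
      set α := min 1 (τ / ‖g‖)
      have hα0 : 0 ≤ α := le_min zero_le_one (by positivity)
      have hα1 : α ≤ 1 := min_le_left _ _
      have e : ⟪Δ, g⟫ = ⟪Δ, v⟫ + ⟪Δ, g - v⟫ := by rw [← inner_add_right, add_sub_cancel]
      have hv : 0 ≤ ⟪Δ, v⟫ := le_trans (by positivity) h1
      have hc := real_inner_le_norm Δ (g - v)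
      have hn : 0 ≤ ‖Δ‖ * ‖g - v‖ := by positivity
      rw [e]
      nlinarith [mul_nonneg hα0 hv, mul_le_mul_of_nonneg_left hc (sub_nonneg.2 hα1),
        mul_nonneg hα0 hn]
  rw [norm_sub_sq_real, real_inner_smul_right, norm_smul, Real.norm_of_nonneg hβ, mul_pow]
  have := mul_le_mul_of_nonneg_left hI hβ
  have := mul_le_mul_of_nonneg_left hH (sq_nonneg β)
  linarith

section Drift

variable {d : ℕ} (DO DI : Kernel (Param d) (Param d)) [IsMarkovKernel DO] [IsMarkovKernel DI]
  {β μ L p q σ η : ℝ} {θ θs v : Param d}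

theorem integrable_norm_qcStep_sub_sq (hβ : 0 ≤ β) (hp0 : 0 < p) (hp : p < 1)
    (ν : Measure (Param d)) [IsFiniteMeasure ν] :
    Integrable (fun g => ‖qcStep DI β p θ g - θs‖ ^ 2) ν := by
  refine Integrable.of_bound (C := (‖θ - θs‖ + β * threshold DI p θ) ^ 2) ?_
    (Filter.Eventually.of_forall fun g => ?_)
  · have : Measurable fun g => qcStep DI β p θ g :=
      (measurable_qcStep DI β p).comp measurable_prodMk_left
    exact ((this.sub_const θs).norm.pow_const 2).aestronglyMeasurable
  · rw [Real.norm_of_nonneg (by positivity)]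
    exact pow_le_pow_left₀ (norm_nonneg _)
      (norm_qcStep_sub_le DI hβ θs θ g (threshold_nonneg DI hp0 hp θ)) 2

/-- Integrate the pointwise expansion: both inner products with the centered noise vanish, the
unclipped event has mass at least `p`, and Hölder bounds the noise on its complement. -/
theorem integral_norm_qcStep_sub_sq_le (hβ : 0 ≤ β) (hμ : 0 ≤ μ) (hp0 : 0 < p) (hp : p < 1)
    (hq : 2 ≤ q) (hσ : 0 ≤ σ)
    (h1 : μ * ‖θ - θs‖ ^ 2 ≤ ⟪θ - θs, v⟫) (h2 : ‖v‖ ≤ L * ‖θ - θs‖)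
    (hmean : ∫ g, (g - v) ∂(DI θ) = 0)
    (hmom : eLpNorm (fun g => g - v) (ENNReal.ofReal q) (DI θ) ≤ ENNReal.ofReal σ) :
    ∫ g, ‖qcStep DI β p θ g - θs‖ ^ 2 ∂(DI θ) ≤ ‖θ - θs‖ ^ 2
      - 2 * β * (μ * ‖θ - θs‖ ^ 2 * p - ‖θ - θs‖ * ((1 - p) ^ (1 - 1 / q) * σ))
      + β ^ 2 * (L ^ 2 * ‖θ - θs‖ ^ 2 + σ ^ 2) := by
  set Δ := θ - θs with hΔ
  set τ := threshold DI p θ with hτdef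
  have hτ : 0 ≤ τ := threshold_nonneg DI hp0 hp θ
  set S : Set (Param d) := {g | ‖g‖ ≤ τ} with hS
  have hSm : MeasurableSet S := measurableSet_le (by fun_prop) (by fun_prop)
  have hpt : ∀ g, ‖qcStep DI β p θ g - θs‖ ^ 2 ≤ ‖Δ‖ ^ 2
      - 2 * β * (S.indicator (fun _ => μ * ‖Δ‖ ^ 2) g + ⟪Δ, g - v⟫
        - ‖Δ‖ * Sᶜ.indicator (fun g => ‖g - v‖) g)
      + β ^ 2 * (L ^ 2 * ‖Δ‖ ^ 2 + 2 * ⟪v, g - v⟫ + ‖g - v‖ ^ 2) := by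
    intro g
    rw [qcStep_eq, sub_right_comm]
    exact norm_sub_smul_clip_sq_le hβ hτ hμ h1 h2
  have m2 := memLp_two_of_eLpNorm_le hq hmom
  have i1 : Integrable (fun g => g - v) (DI θ) := m2.integrable (by norm_num)
  have i2 : Integrable (fun g => ‖g - v‖ ^ 2) (DI θ) := m2.integrable_norm_pow (by norm_num)
  have i3 : Integrable (fun g => ⟪Δ, g - v⟫) (DI θ) := i1.const_inner Δ
  have i4 : Integrable (fun g => ⟪v, g - v⟫) (DI θ) := i1.const_inner v
  have i5 : Integrable (Sᶜ.indicator fun g => ‖g - v‖) (DI θ) := i1.norm.indicator hSm.compl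
  have i6 : Integrable (S.indicator fun _ => μ * ‖Δ‖ ^ 2) (DI θ) :=
    (integrable_const _).indicator hSm
  have z3 : ∫ g, ⟪Δ, g - v⟫ ∂(DI θ) = 0 := by
    rw [integral_inner i1, hmean, inner_zero_right]
  have z4 : ∫ g, ⟪v, g - v⟫ ∂(DI θ) = 0 := by
    rw [integral_inner i1, hmean, inner_zero_right]
  have j1 : Integrable (fun g => S.indicator (fun _ => μ * ‖Δ‖ ^ 2) g + ⟪Δ, g - v⟫) (DI θ) :=
    i6.add i3
  have j2 : Integrable (fun g => S.indicator (fun _ => μ * ‖Δ‖ ^ 2) g + ⟪Δ, g - v⟫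
        - ‖Δ‖ * Sᶜ.indicator (fun g => ‖g - v‖) g) (DI θ) := j1.sub (i5.const_mul _)
  have j3 : Integrable (fun g => L ^ 2 * ‖Δ‖ ^ 2 + 2 * ⟪v, g - v⟫) (DI θ) :=
    (integrable_const _).add (i4.const_mul 2)
  have j4 : Integrable (fun g => L ^ 2 * ‖Δ‖ ^ 2 + 2 * ⟪v, g - v⟫ + ‖g - v‖ ^ 2) (DI θ) :=
    j3.add i2
  have j5 : Integrable (fun g => ‖Δ‖ ^ 2
      - 2 * β * (S.indicator (fun _ => μ * ‖Δ‖ ^ 2) g + ⟪Δ, g - v⟫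
        - ‖Δ‖ * Sᶜ.indicator (fun g => ‖g - v‖) g)) (DI θ) :=
    (integrable_const _).sub (j2.const_mul _)
  have hle := integral_mono (integrable_norm_qcStep_sub_sq DI hβ hp0 hp (DI θ))
    (j5.add (j4.const_mul (β ^ 2))) hpt
  refine hle.trans ?_
  simp only [Pi.add_apply]
  rw [integral_add j5 (j4.const_mul _), integral_sub (integrable_const _) (j2.const_mul _),
    integral_const_mul, integral_const_mul, integral_add j3 i2,
    integral_add (integrable_const _) (i4.const_mul 2), integral_const_mul 2, z4,
    integral_sub j1 (i5.const_mul _), integral_add i6 i3, z3, integral_const_mul,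
    integral_indicator hSm.compl, integral_indicator hSm]
  simp only [integral_const, probReal_univ, smul_eq_mul, one_mul, measureReal_restrict_apply_univ]
  have b1 := integral_norm_sq_le hq hσ hmom
  have b2 := setIntegral_norm_le hq hσ hmom Sᶜ
  have b3 : p ≤ (DI θ).real S := le_measure_norm_le_threshold DI hp θ
  have b4 : (DI θ).real Sᶜ ≤ 1 - p := by
    rw [probReal_compl_eq_one_sub hSm]; linarith
  have b5 : (DI θ).real Sᶜ ^ (1 - 1 / q) ≤ (1 - p) ^ (1 - 1 / q) := by
    refine Real.rpow_le_rpow measureReal_nonneg b4 ?_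
    have : 1 / q ≤ 1 := (div_le_one (by linarith)).2 (by linarith)
    linarith
  have b6 : ∫ g in Sᶜ, ‖g - v‖ ∂(DI θ) ≤ (1 - p) ^ (1 - 1 / q) * σ :=
    b2.trans (mul_le_mul_of_nonneg_right b5 hσ)
  have c1 := mul_le_mul_of_nonneg_left b6 (norm_nonneg Δ)
  have c2 := mul_le_mul_of_nonneg_right b3 (by positivity : 0 ≤ μ * ‖Δ‖ ^ 2)
  have c3 := mul_le_mul_of_nonneg_left b1 (sq_nonneg β)
  have c4 := mul_le_mul_of_nonneg_left c1 hβ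
  have c5 := mul_le_mul_of_nonneg_left c2 hβ
  linarith

end Drift

/-- Here `e` stands for `η^(-1/q)` and `D` for the distance to the minimizer; `q ≥ 2` enters through
`η e² ≤ 1`. The definition of `κ` matches the first-order terms since `1 - (1 - η)² = η (2 - η)`.
The final constants are `-2 + 1 + 1/10 = -9/10` and `4 + 6 = 10`. -/
theorem drift_arith {η e A B L μ κ β D τ : ℝ} (hη0 : 0 < η) (hη : η < 1 / 2)
    (he : 1 ≤ e) (heη : η * e ^ 2 ≤ 1) (hA : 0 < A) (hB : 0 < B) (hβ0 : 0 < β) (hκ : 0 < κ)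
    (hκdef : κ = (1 - η) * (1 - η) * μ - η * L - e * A * (1 - (1 - η) * (1 - η)))
    (hβ : β < 1 / 4 * (κ / (μ ^ 2 + 6 * L ^ 2 + 16 * e ^ 2 * A ^ 2)))
    (hβ' : β ≤ (η * e) ^ 2 / κ) (hD : 0 ≤ D) (hτ0 : 0 ≤ τ)
    (hτ : τ ≤ L * D + e * (A * D + B)) :
    η * (D + β * τ) ^ 2 + (1 - η) * (D ^ 2 - 2 * β * (μ * D ^ 2 * (1 - η)
        - D * (η * e * (A * D + B))) + β ^ 2 * (L ^ 2 * D ^ 2 + (A * D + B) ^ 2))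
      ≤ (1 - 9 / 10 * (β * κ)) * D ^ 2 + 10 * (β * κ) * (η * e * B / κ) ^ 2 := by
  set σ := A * D + B with hσ
  have hσ0 : 0 < σ := by positivity
  have hden : 0 < μ ^ 2 + 6 * L ^ 2 + 16 * e ^ 2 * A ^ 2 := by positivity
  have hβ1 : β * (μ ^ 2 + 6 * L ^ 2 + 16 * e ^ 2 * A ^ 2) < 1 / 4 * κ := by
    rw [← mul_div_assoc, lt_div_iff₀ hden] at hβ
    exact hβ
  have he2 : 1 ≤ e ^ 2 := one_le_pow₀ he
  have hβ2 : β * (3 / 2 * L ^ 2 + 6 * A ^ 2) ≤ 1 / 10 * κ := by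
    have : A ^ 2 ≤ e ^ 2 * A ^ 2 := le_mul_of_one_le_left (sq_nonneg A) he2
    have h2 : 3 / 2 * L ^ 2 + 6 * A ^ 2
        ≤ 3 / 8 * (μ ^ 2 + 6 * L ^ 2 + 16 * e ^ 2 * A ^ 2) := by
      nlinarith [sq_nonneg μ, sq_nonneg L]
    have := mul_le_mul_of_nonneg_left h2 hβ0.le
    linarith
  set a := η * e * B / κ with ha
  have ha' : η * e * B = κ * a := by rw [ha]; field_simp
  -- This is where the second step-size condition is used: it makes the noise floor `β B²`
  -- comparable to `κ a²`.
  have hβ3 : β * B ^ 2 ≤ κ * a ^ 2 := by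
    have h1 : β * κ ≤ (η * e) ^ 2 := (le_div_iff₀ hκ).1 hβ'
    have h2 : κ * (β * B ^ 2) ≤ κ * (κ * a ^ 2) := by
      calc κ * (β * B ^ 2) = (β * κ) * B ^ 2 := by ring
        _ ≤ (η * e) ^ 2 * B ^ 2 := by gcongr
        _ = (η * e * B) ^ 2 := by ring
        _ = κ * (κ * a ^ 2) := by rw [ha']; ring
    exact le_of_mul_le_mul_left h2 hκ
  have hτ2 : τ ^ 2 ≤ 2 * L ^ 2 * D ^ 2 + 2 * e ^ 2 * σ ^ 2 := by
    have := pow_le_pow_left₀ hτ0 hτ 2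
    nlinarith [sq_nonneg (L * D - e * σ)]
  have hσ2 : σ ^ 2 ≤ 2 * A ^ 2 * D ^ 2 + 2 * B ^ 2 := by
    rw [hσ]; nlinarith [sq_nonneg (A * D - B)]
  have hsecond : η * τ ^ 2 + (1 - η) * (L ^ 2 * D ^ 2 + σ ^ 2)
      ≤ (3 / 2 * L ^ 2 + 6 * A ^ 2) * D ^ 2 + 6 * B ^ 2 := by
    have h1 := mul_le_mul_of_nonneg_left hτ2 hη0.le
    have h2 : η * e ^ 2 * σ ^ 2 ≤ 1 * σ ^ 2 := by gcongr
    have h3 : 0 ≤ L ^ 2 * D ^ 2 := by positivity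
    have h4 : η * (L ^ 2 * D ^ 2) ≤ 1 / 2 * (L ^ 2 * D ^ 2) := by gcongr
    have h5 : 0 ≤ η * σ ^ 2 := by positivity
    linarith
  have hsecond' : β ^ 2 * (η * τ ^ 2 + (1 - η) * (L ^ 2 * D ^ 2 + σ ^ 2))
      ≤ β * (1 / 10 * κ * D ^ 2 + 6 * (κ * a ^ 2)) := by
    have h1 := mul_le_mul_of_nonneg_left hsecond hβ0.le
    have h2 := mul_le_mul_of_nonneg_right hβ2 (sq_nonneg D)
    have h3 : β * (η * τ ^ 2 + (1 - η) * (L ^ 2 * D ^ 2 + σ ^ 2))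
      ≤ 1 / 10 * κ * D ^ 2 + 6 * (κ * a ^ 2) := by linarith
    have h4 := mul_le_mul_of_nonneg_left h3 hβ0.le
    linarith
  have hfirst : η * (D * τ) - (1 - η) * (μ * D ^ 2 * (1 - η) - D * (η * e * σ))
      ≤ - κ * D ^ 2 + 2 * (κ * a * D) := by
    have h1 : η * (D * τ) ≤ η * (D * (L * D + e * σ)) := by gcongr
    have h2 : η * (D * (L * D + e * σ)) - (1 - η) * (μ * D ^ 2 * (1 - η) - D * (η * e * σ))
        = -κ * D ^ 2 + (2 - η) * (η * e * B) * D := by rw [hκdef, hσ]; ring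
    have h3 : 0 ≤ η * (η * e * B * D) := by positivity
    calc _ ≤ η * (D * (L * D + e * σ)) - (1 - η) * (μ * D ^ 2 * (1 - η) - D * (η * e * σ)) :=
          sub_le_sub_right h1 _
      _ = -κ * D ^ 2 + (2 - η) * (η * e * B) * D := h2
      _ ≤ -κ * D ^ 2 + 2 * (η * e * B * D) := by linarith only [h3]
      _ = _ := by rw [ha']
  -- Young's inequality, weighted so that the cross term consumes half of the first-order
  -- contraction `2βκ D²`.
  have hcross : 4 * (a * D) ≤ D ^ 2 + 4 * a ^ 2 := by
    have := sq_nonneg (D - 2 * a)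
    linarith only [this]
  have h6 := mul_le_mul_of_nonneg_left hfirst hβ0.le
  have h7 := mul_le_mul_of_nonneg_left hcross (mul_pos hβ0 hκ).le
  linarith only [h6, h7, hsecond']

theorem one_le_rpow_neg_inv {η q : ℝ} (hη0 : 0 < η) (hη : η < 1 / 2) (hq : 2 ≤ q) :
    1 ≤ η ^ (-(1 / q)) :=
  Real.one_le_rpow_of_pos_of_le_one_of_nonpos hη0 (by linarith)
    (neg_nonpos.2 (by positivity))

theorem rpow_neg_two_div {η q : ℝ} (hη0 : 0 < η) : η ^ (-(2 / q)) = (η ^ (-(1 / q))) ^ 2 := by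
  rw [← Real.rpow_natCast, ← Real.rpow_mul hη0.le]; congr 1; push_cast; ring

theorem rpow_one_sub_inv {η q : ℝ} (hη0 : 0 < η) : η ^ (1 - 1 / q) = η * η ^ (-(1 / q)) := by
  rw [sub_eq_add_neg, Real.rpow_add hη0, Real.rpow_one]

theorem rpow_two_sub {η q : ℝ} (hη0 : 0 < η) :
    η ^ (2 - 2 / q) = (η * η ^ (-(1 / q))) ^ 2 := by
  rw [sub_eq_add_neg, Real.rpow_add hη0, rpow_neg_two_div hη0, mul_pow, Real.rpow_ofNat]

theorem mul_rpow_neg_sq_le {η q : ℝ} (hη0 : 0 < η) (hη : η < 1 / 2) (hq : 2 ≤ q) :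
    η * (η ^ (-(1 / q))) ^ 2 ≤ 1 := by
  have h : 0 ≤ 1 + -(2 / q) := by
    have : 2 / q ≤ 1 := (div_le_one (by linarith)).2 hq
    linarith
  calc η * (η ^ (-(1 / q))) ^ 2 = η ^ (1 + -(2 / q)) := by
        rw [Real.rpow_add hη0, Real.rpow_one, rpow_neg_two_div hη0]
    _ ≤ 1 := Real.rpow_le_one hη0.le (by linarith) h

/-- Contraction of the expected squared distance to the minimizer in one step of the chain, up to
a constant. -/
theorem lintegral_qcKernel_le {d : ℕ}
    {ℒ : Param d → ℝ} {L μ : ℝ} (hsmooth : LipschitzSmooth ℒ L) (hconv : StronglyConvex ℒ μ)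
    {θs : Param d} (hθs : ∀ θ, ℒ θs ≤ ℒ θ)
    {η : ℝ} (hη0 : 0 < η) (hη : η < 1 / 2)
    {DO DI : Kernel (Param d) (Param d)} [IsMarkovKernel DO] [IsMarkovKernel DI]
    (hnoise : CenteredDiffuseNoise ℒ DI)
    {q A B : ℝ} (hq : 2 ≤ q) (hA : 0 < A) (hB : 0 < B) (hmom : NoiseMomentBound ℒ DI θs q A B)
    {κ β : ℝ} (hκdef : κ = kappa η (1 - η) μ L q A) (hκ : 0 < κ) (hβ0 : 0 < β)
    (hβ : β < 1 / 4 * (κ / (μ ^ 2 + 6 * L ^ 2 + 16 * η ^ (-(2 / q)) * A ^ 2)))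
    (hβ' : β ≤ η ^ (2 - 2 / q) / κ) (θ : Param d) :
    ∫⁻ x, ENNReal.ofReal (‖x - θs‖ ^ 2) ∂(qcKernel η DO DI β (1 - η) θ) ≤
      ENNReal.ofReal ((1 - 9 / 10 * (β * κ)) * ‖θ - θs‖ ^ 2
        + 10 * (β * κ) * (η ^ (1 - 1 / q) * B / κ) ^ 2) := by
  set p := 1 - η with hp
  have hp0 : 0 < p := by linarith
  have hp1 : p < 1 := by linarith
  have hpη : 1 - p = η := by linarith
  set v := gradient ℒ θ with hv
  set σ := A * ‖θ - θs‖ + B with hσdef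
  have hσ : 0 ≤ σ := by positivity
  have hsub : Measurable fun g : Param d => g - v := by fun_prop
  have hm : eLpNorm (fun g => g - v) (ENNReal.ofReal q) (DI θ) ≤ ENNReal.ofReal σ := by
    have := hmom θ
    rw [noiseLaw, eLpNorm_map_measure (by fun_prop) hsub.aemeasurable] at this
    exact this
  have hmean : ∫ g, (g - v) ∂(DI θ) = 0 := by
    have := (hnoise.1 θ).2
    rwa [noiseLaw, integral_map hsub.aemeasurable (by fun_prop)] at this
  have hI := integral_norm_qcStep_sub_sq_le DI hβ0.le hconv.2.1.le hp0 hp1 hq hσ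
    (le_inner_gradient hconv hθs θ) (norm_gradient_le hsmooth hconv hθs θ) hmean hm
  have hτ0 := threshold_nonneg DI hp0 hp1 θ
  have hτ : threshold DI p θ ≤ L * ‖θ - θs‖ + η ^ (-(1 / q)) * σ := by
    have h1 := threshold_le DI hp0 hp1 θ hq hσ hm
    rw [hpη] at h1
    linarith [norm_gradient_le hsmooth hconv hθs θ]
  have hO : ∫⁻ g, ENNReal.ofReal (‖qcStep DI β p θ g - θs‖ ^ 2) ∂(DO θ)
      ≤ ENNReal.ofReal ((‖θ - θs‖ + β * threshold DI p θ) ^ 2) := by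
    calc _ ≤ ∫⁻ _, ENNReal.ofReal ((‖θ - θs‖ + β * threshold DI p θ) ^ 2) ∂(DO θ) :=
          lintegral_mono fun g => ENNReal.ofReal_le_ofReal
            (pow_le_pow_left₀ (norm_nonneg _) (norm_qcStep_sub_le DI hβ0.le θs θ g hτ0) 2)
      _ = _ := by simp
  have hI' : ∫⁻ g, ENNReal.ofReal (‖qcStep DI β p θ g - θs‖ ^ 2) ∂(DI θ)
      = ENNReal.ofReal (∫ g, ‖qcStep DI β p θ g - θs‖ ^ 2 ∂(DI θ)) :=
    (ofReal_integral_eq_lintegral_ofReal (integrable_norm_qcStep_sub_sq DI hβ0.le hp0 hp1 _)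
      (Filter.Eventually.of_forall fun g => by positivity)).symm
  have hstep : Measurable (qcStep DI β p θ) :=
    (measurable_qcStep DI β p).comp measurable_prodMk_left
  have hK : qcKernel η DO DI β p θ
      = (ENNReal.ofReal η • DO θ + ENNReal.ofReal (1 - η) • DI θ).map (qcStep DI β p θ) := rfl
  rw [hK, lintegral_map (by fun_prop) hstep, lintegral_add_measure, lintegral_smul_measure,
    lintegral_smul_measure, hI', smul_eq_mul, smul_eq_mul]
  refine (add_le_add (mul_le_mul_right hO _)
    (mul_le_mul_right (ENNReal.ofReal_le_ofReal hI) _)).trans ?_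
  have hn1 : 0 ≤ ‖θ - θs‖ ^ 2
      - 2 * β * (μ * ‖θ - θs‖ ^ 2 * p - ‖θ - θs‖ * ((1 - p) ^ (1 - 1 / q) * σ))
      + β ^ 2 * (L ^ 2 * ‖θ - θs‖ ^ 2 + σ ^ 2) :=
    le_trans (integral_nonneg fun g => by positivity) hI
  rw [← ENNReal.ofReal_mul hη0.le, ← ENNReal.ofReal_mul (by linarith),
    ← ENNReal.ofReal_add (by positivity) (mul_nonneg (by linarith) hn1)]
  refine ENNReal.ofReal_le_ofReal ?_
  rw [hpη, rpow_one_sub_inv hη0, hp]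
  refine drift_arith hη0 hη (one_le_rpow_neg_inv hη0 hη hq) (mul_rpow_neg_sq_le hη0 hη hq) hA hB
    hβ0 hκ ?_ ?_ ?_ (norm_nonneg _) hτ0 hτ
  · rw [hκdef, kappa, ← hp, hpη]
  · rwa [← rpow_neg_two_div hη0]
  · rwa [← rpow_two_sub hη0]

/-- Since `κ ≤ μ + |L|`, its square is at most twice the denominator in the step-size bound. It
keeps the contraction factor `1 - 9βκ/10` nonnegative. -/
theorem mul_kappa_le {η q A L μ κ β : ℝ} (hη0 : 0 < η) (hη : η < 1 / 2) (hμ : 0 < μ) (hA : 0 < A)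
    (hκdef : κ = kappa η (1 - η) μ L q A) (hκ : 0 < κ)
    (hβ : β < 1 / 4 * (κ / (μ ^ 2 + 6 * L ^ 2 + 16 * η ^ (-(2 / q)) * A ^ 2))) :
    β * κ ≤ 1 / 2 := by
  have h1 : κ ≤ μ + |L| := by
    have h2 : 0 ≤ (1 - (1 - η)) ^ (-(1 / q)) * A * (1 - (1 - η) * (1 - η)) := by
      have : (0 : ℝ) ≤ 1 - (1 - η) := by linarith
      have : (0 : ℝ) ≤ 1 - (1 - η) * (1 - η) := by nlinarith
      positivity
    have h3 : -(η * L) ≤ |L| := by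
      have := neg_le_abs L
      have := abs_nonneg L
      nlinarith
    have h4 : (1 - η) * (1 - η) * μ ≤ μ := by
      have : (1 - η) * (1 - η) ≤ 1 := by nlinarith
      nlinarith
    rw [hκdef, kappa]
    linarith
  have hden : 0 < μ ^ 2 + 6 * L ^ 2 + 16 * η ^ (-(2 / q)) * A ^ 2 := by positivity
  have h2 : κ ^ 2 ≤ 2 * (μ ^ 2 + 6 * L ^ 2 + 16 * η ^ (-(2 / q)) * A ^ 2) := by
    have h3 := pow_le_pow_left₀ hκ.le h1 2
    have h4 : 0 ≤ 16 * η ^ (-(2 / q)) * A ^ 2 := by positivity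
    nlinarith [sq_nonneg (μ - |L|), sq_abs L]
  have h3 := mul_le_mul_of_nonneg_right hβ.le hκ.le
  have h4 : 1 / 4 * (κ / (μ ^ 2 + 6 * L ^ 2 + 16 * η ^ (-(2 / q)) * A ^ 2)) * κ ≤ 1 / 2 := by
    rw [← mul_div_assoc, div_mul_eq_mul_div, div_le_iff₀ hden]
    nlinarith
  linarith

/-! ### Laws of the chain -/

section Chain

variable {d : ℕ}

theorem isProbabilityMeasure_corruptedGradient {η : ℝ} (hη0 : 0 ≤ η) (hη1 : η ≤ 1)
    (DO DI : Kernel (Param d) (Param d)) [IsMarkovKernel DO] [IsMarkovKernel DI] (θ : Param d) :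
    IsProbabilityMeasure (corruptedGradient η DO DI θ) := by
  refine ⟨?_⟩
  have h : corruptedGradient η DO DI θ
      = ENNReal.ofReal η • DO θ + ENNReal.ofReal (1 - η) • DI θ := rfl
  rw [h]
  simp only [Measure.add_apply, Measure.smul_apply, measure_univ, smul_eq_mul, mul_one]
  rw [← ENNReal.ofReal_add hη0 (sub_nonneg.2 hη1)]
  simp

theorem isMarkovKernel_qcKernel {η : ℝ} (hη0 : 0 ≤ η) (hη1 : η ≤ 1)
    (DO DI : Kernel (Param d) (Param d)) [IsMarkovKernel DO] [IsMarkovKernel DI] (β p : ℝ) :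
    IsMarkovKernel (qcKernel η DO DI β p) := by
  refine ⟨fun θ => ?_⟩
  have hstep : Measurable (qcStep DI β p θ) :=
    (measurable_qcStep DI β p).comp measurable_prodMk_left
  have := isProbabilityMeasure_corruptedGradient hη0 hη1 DO DI θ
  exact Measure.isProbabilityMeasure_map hstep.aemeasurable

theorem lawAfter_zero (P : Kernel (Param d) (Param d)) (ν : Measure (Param d)) :
    lawAfter P ν 0 = ν := rfl

theorem lawAfter_succ (P : Kernel (Param d) (Param d)) (ν : Measure (Param d)) (t : ℕ) :
    lawAfter P ν (t + 1) = (lawAfter P ν t).bind P :=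
  Function.iterate_succ_apply' _ _ _

theorem isProbabilityMeasure_bind (P : Kernel (Param d) (Param d)) [IsMarkovKernel P]
    (ν : Measure (Param d)) [IsProbabilityMeasure ν] : IsProbabilityMeasure (ν.bind P) := by
  refine ⟨?_⟩
  rw [Measure.bind_apply MeasurableSet.univ P.measurable.aemeasurable]
  simp

instance isProbabilityMeasure_lawAfter (P : Kernel (Param d) (Param d)) [IsMarkovKernel P]
    (ν : Measure (Param d)) [IsProbabilityMeasure ν] (t : ℕ) :
    IsProbabilityMeasure (lawAfter P ν t) := by
  induction t with
  | zero => assumption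
  | succ t ih => rw [lawAfter_succ]; exact isProbabilityMeasure_bind P _

theorem abs_real_sub_le_one {X : Type*} [MeasurableSpace X] {μ ν : Measure X}
    [IsProbabilityMeasure μ] [IsProbabilityMeasure ν]
    (S : Set X) : |μ.real S - ν.real S| ≤ 1 := by
  have h1 : μ.real S ≤ 1 := measureReal_le_one
  have h2 : ν.real S ≤ 1 := measureReal_le_one
  have h3 : 0 ≤ μ.real S := measureReal_nonneg
  have h4 : 0 ≤ ν.real S := measureReal_nonneg
  rw [abs_le]
  constructor <;> linarith

theorem abs_sub_le_tvDist (ν₁ ν₂ : Measure (Param d)) [IsProbabilityMeasure ν₁]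
    [IsProbabilityMeasure ν₂] {S : Set (Param d)} (hS : MeasurableSet S) :
    |ν₁.real S - ν₂.real S| ≤ tvDist ν₁ ν₂ := by
  refine le_ciSup (f := fun A : {A : Set (Param d) // MeasurableSet A} =>
    |ν₁.real A - ν₂.real A|) ⟨1, ?_⟩ ⟨S, hS⟩
  rintro _ ⟨A, rfl⟩
  exact abs_real_sub_le_one _

/-- `P` contracts the mean squared distance to `θs` by the factor `1 - γ`, up to a constant. -/
def Drift (P : Kernel (Param d) (Param d)) (θs : Param d) (γ b : ℝ) : Prop :=
  ∀ θ, ∫⁻ x, ENNReal.ofReal (‖x - θs‖ ^ 2) ∂(P θ)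
    ≤ ENNReal.ofReal ((1 - γ) * ‖θ - θs‖ ^ 2 + b)

variable {P : Kernel (Param d) (Param d)} [IsMarkovKernel P] {θs : Param d} {γ b : ℝ}

/-- `b / γ` is the fixed point of `s ↦ (1 - γ) s + b`, so the excess over it shrinks by `1 - γ` at
each step. -/
theorem Drift.lintegral_lawAfter_le (hP : Drift P θs γ b) (hγ0 : 0 < γ) (hγ1 : γ ≤ 1)
    (hb : 0 ≤ b) (x : Param d) (t : ℕ) :
    ∫⁻ y, ENNReal.ofReal (‖y - θs‖ ^ 2) ∂(lawAfter P (Measure.dirac x) t)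
      ≤ ENNReal.ofReal ((1 - γ) ^ t * ‖x - θs‖ ^ 2 + b / γ) := by
  have hγ : 0 ≤ 1 - γ := by linarith
  induction t with
  | zero =>
    rw [lawAfter_zero, lintegral_dirac' _ (by fun_prop)]
    refine ENNReal.ofReal_le_ofReal ?_
    have : 0 ≤ b / γ := by positivity
    simpa using this
  | succ t ih =>
    rw [lawAfter_succ, Measure.lintegral_bind P.measurable.aemeasurable (by fun_prop)]
    calc _ ≤ ∫⁻ θ, ENNReal.ofReal ((1 - γ) * ‖θ - θs‖ ^ 2 + b)
            ∂(lawAfter P (Measure.dirac x) t) := lintegral_mono hP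
      _ = ∫⁻ θ, ENNReal.ofReal (1 - γ) * ENNReal.ofReal (‖θ - θs‖ ^ 2) + ENNReal.ofReal b
            ∂(lawAfter P (Measure.dirac x) t) := by
          refine lintegral_congr fun θ => ?_
          rw [ENNReal.ofReal_add (by positivity) hb, ENNReal.ofReal_mul hγ]
      _ = ENNReal.ofReal (1 - γ) * ∫⁻ θ, ENNReal.ofReal (‖θ - θs‖ ^ 2)
            ∂(lawAfter P (Measure.dirac x) t) + ENNReal.ofReal b := by
          rw [lintegral_add_right _ measurable_const, lintegral_const_mul _ (by fun_prop)]
          simp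
      _ ≤ ENNReal.ofReal (1 - γ) * ENNReal.ofReal ((1 - γ) ^ t * ‖x - θs‖ ^ 2 + b / γ)
            + ENNReal.ofReal b := by gcongr
      _ = _ := by
          rw [← ENNReal.ofReal_mul hγ, ← ENNReal.ofReal_add (by positivity) hb]
          congr 1
          field_simp
          ring

theorem Drift.measure_lawAfter_le (hP : Drift P θs γ b) (hγ0 : 0 < γ) (hγ1 : γ ≤ 1)
    (hb : 0 ≤ b) (x : Param d) (t : ℕ) {r : ℝ} (hr : 0 < r) :
    (lawAfter P (Measure.dirac x) t).real {y | r ≤ ‖y - θs‖}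
      ≤ ((1 - γ) ^ t * ‖x - θs‖ ^ 2 + b / γ) / r ^ 2 := by
  have hγ : 0 ≤ 1 - γ := by linarith
  have h1 := (mul_meas_ge_le_lintegral (μ := lawAfter P (Measure.dirac x) t)
    (f := fun y => ENNReal.ofReal (‖y - θs‖ ^ 2)) (by fun_prop)
    (ENNReal.ofReal (r ^ 2))).trans (hP.lintegral_lawAfter_le hγ0 hγ1 hb x t)
  have hset : {y | ENNReal.ofReal (r ^ 2) ≤ ENNReal.ofReal (‖y - θs‖ ^ 2)}
      = {y | r ≤ ‖y - θs‖} := by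
    ext y
    simp only [Set.mem_ofPred_eq]
    rw [ENNReal.ofReal_le_ofReal_iff (by positivity), pow_le_pow_iff_left₀ hr.le (norm_nonneg _)
      two_ne_zero]
  rw [hset, ← ofReal_measureReal, ← ENNReal.ofReal_mul (by positivity),
    ENNReal.ofReal_le_ofReal_iff (by positivity)] at h1
  rw [le_div_iff₀ (by positivity), mul_comm]
  exact h1

theorem measurableSet_le_norm_sub (θs : Param d) (r : ℝ) :
    MeasurableSet {y : Param d | r ≤ ‖y - θs‖} :=
  measurableSet_le (by fun_prop) (by fun_prop)

/-- The tail bound passes to the limit along the chain from `θ₀`. No second moment of `π` has to be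
known beforehand. -/
theorem Drift.measure_limit_le (hP : Drift P θs γ b) (hγ0 : 0 < γ) (hγ1 : γ ≤ 1) (hb : 0 ≤ b)
    {θ₀ : Param d} {π : Measure (Param d)} {M ρ : ℝ}
    (hπ : GeometricConvergence P θs θ₀ π M ρ) {r : ℝ} (hr : 0 < r) :
    π.real {y | r ≤ ‖y - θs‖} ≤ b / γ / r ^ 2 := by
  obtain ⟨hprob, -, hM, hρ0, hρ1, htv⟩ := hπ
  have h1 : ∀ t : ℕ, π.real {y | r ≤ ‖y - θs‖}
      ≤ ((1 - γ) ^ t * ‖θ₀ - θs‖ ^ 2 + b / γ) / r ^ 2 + M * ρ ^ t * (1 + ‖θ₀ - θs‖ ^ 2) := by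
    intro t
    have h2 := hP.measure_lawAfter_le hγ0 hγ1 hb θ₀ t hr
    have h3 := (abs_sub_le_tvDist (lawAfter P (Measure.dirac θ₀) t) π
      (measurableSet_le_norm_sub θs r)).trans (htv t)
    have h4 := neg_le_of_abs_le h3
    linarith
  have l1 : Filter.Tendsto (fun t : ℕ => (1 - γ) ^ t) Filter.atTop (nhds 0) :=
    tendsto_pow_atTop_nhds_zero_of_lt_one (by linarith) (by linarith)
  have l2 : Filter.Tendsto (fun t : ℕ => ρ ^ t) Filter.atTop (nhds 0) :=
    tendsto_pow_atTop_nhds_zero_of_lt_one hρ0.le hρ1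
  have l3 := (((l1.mul_const (‖θ₀ - θs‖ ^ 2)).add_const (b / γ)).div_const (r ^ 2)).add
    ((l2.const_mul M).mul_const (1 + ‖θ₀ - θs‖ ^ 2))
  simp only [zero_mul, mul_zero, zero_add, add_zero] at l3
  exact ge_of_tendsto' l3 h1

/-- The natural-number ceiling `⌈·⌉₊` is zero on negative reals, which covers the case where no
burn-in is required. -/
theorem mul_pow_le_one_of_ceil_le {M ρ X : ℝ} (hX : 0 < X) (hM : 0 < M) (hρ0 : 0 < ρ)
    (hρ1 : ρ < 1) {k : ℕ} (hk : ⌈Real.log (15 * M * X) / Real.log (1 / ρ)⌉₊ ≤ k) :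
    M * ρ ^ k * X ≤ 1 / 15 := by
  have hlog : 0 < Real.log (1 / ρ) := Real.log_pos ((one_lt_div hρ0).2 hρ1)
  have h1 : Real.log (15 * M * X) / Real.log (1 / ρ) ≤ k := Nat.ceil_le.1 hk
  rw [div_le_iff₀ hlog, ← Real.log_pow, Real.log_le_log_iff (by positivity) (by positivity),
    one_div, inv_pow, le_inv_comm₀ (by positivity) (by positivity)] at h1
  have h2 := mul_le_mul_of_nonneg_left h1 (by positivity : 0 ≤ 15 * M * X)
  rw [mul_inv_cancel₀ (by positivity)] at h2
  linarith

theorem Drift.measure_lawAfter_le_of_geometricConvergence (hP : Drift P θs γ b) (hγ0 : 0 < γ)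
    (hγ1 : γ ≤ 1) (hb : 0 ≤ b) {θ₀ : Param d} {π : Measure (Param d)} {M ρ : ℝ}
    (hπ : GeometricConvergence P θs θ₀ π M ρ) {r : ℝ} (hr : 0 < r) {k : ℕ}
    (hk : ⌈Real.log (15 * M * (1 + ‖θ₀ - θs‖ ^ 2)) / Real.log (1 / ρ)⌉₊ ≤ k) :
    (lawAfter P (Measure.dirac θ₀) k).real {y | r ≤ ‖y - θs‖} ≤ b / γ / r ^ 2 + 1 / 15 := by
  have h1 := hP.measure_limit_le hγ0 hγ1 hb hπ hr
  obtain ⟨hprob, -, hM, hρ0, hρ1, htv⟩ := hπ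
  have h3 := (abs_sub_le_tvDist (lawAfter P (Measure.dirac θ₀) k) π
    (measurableSet_le_norm_sub θs r)).trans (htv k)
  have h4 := mul_pow_le_one_of_ceil_le (by positivity) hM hρ0 hρ1 hk
  have h5 := le_of_abs_le h3
  linarith

end Chain

/-! ### The aggregation step -/

section Aggregate

variable {d N : ℕ} (hN : 0 < N)

/-- Otherwise every index with `f i ≤ c` would occupy one of the `k` sorted positions before `k`. -/
theorem sort_le_of_lt_card {f : Fin N → ℝ} {c : ℝ} (k : Fin N)
    (h : (k : ℕ) < (Finset.univ.filter fun i => f i ≤ c).card) : f (Tuple.sort f k) ≤ c := by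
  by_contra hc
  have hsub : (Finset.univ.filter fun i => f i ≤ c)
      ⊆ (Finset.univ.filter fun i : Fin N => i < k).image (Tuple.sort f) := by
    intro i hi
    refine Finset.mem_image.2 ⟨(Tuple.sort f).symm i, ?_, by simp⟩
    simp only [Finset.mem_filter, Finset.mem_univ, true_and] at hi ⊢
    by_contra hlt
    have := Tuple.monotone_sort f (not_lt.1 hlt)
    simp only [Function.comp_apply, Equiv.apply_symm_apply] at this
    linarith
  have h1 := (Finset.card_le_card hsub).trans Finset.card_image_le
  have h2 : (Finset.univ.filter fun i : Fin N => i < k).card = k := by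
    rw [Finset.filter_gt_eq_Iio, Fin.card_Iio]
  omega

theorem lt_card_of_sort_le {f : Fin N → ℝ} {c : ℝ} (k : Fin N) (h : f (Tuple.sort f k) ≤ c) :
    (k : ℕ) < (Finset.univ.filter fun i => f i ≤ c).card := by
  have hsub : (Finset.univ.filter fun i : Fin N => i ≤ k).image (Tuple.sort f)
      ⊆ Finset.univ.filter fun i => f i ≤ c := by
    intro i hi
    obtain ⟨j, hj, rfl⟩ := Finset.mem_image.1 hi
    simp only [Finset.mem_filter, Finset.mem_univ, true_and] at hj ⊢
    exact (Tuple.monotone_sort f hj).trans h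
  have h1 := Finset.card_le_card hsub
  rw [Finset.card_image_of_injective _ (Tuple.sort f).injective, Finset.filter_ge_eq_Iic,
    Fin.card_Iic] at h1
  omega

/-- If more than half of the points lie within `r` of `c`, then the aggregate lies within `3 r`. -/
theorem IsAggregate.norm_sub_le_three_mul {x : Fin N → Param d} {y c : Param d} {r : ℝ}
    (hx : N < 2 * (Finset.univ.filter fun i => ‖x i - c‖ ≤ r).card)
    (hy : IsAggregate hN x y) : ‖y - c‖ ≤ 3 * r := by
  obtain ⟨i, hi, rfl⟩ := hy
  set G := Finset.univ.filter fun i => ‖x i - c‖ ≤ r with hG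
  have hpos : 0 < G.card := by omega
  obtain ⟨j, hj⟩ := Finset.card_pos.1 hpos
  have hmem : ∀ k, k ∈ G ↔ ‖x k - c‖ ≤ r := by simp [hG]
  have hjr : medianDist hN x j ≤ 2 * r := by
    -- Position `(N - 1) / 2`, counted from zero, is the `⌈N/2⌉`-th smallest. A good point has all
    -- good points within `2r`, so its median distance is at most `2r`, and by minimality so is that
    -- of the aggregate.
    refine sort_le_of_lt_card (f := fun k => ‖x j - x k‖) ⟨(N - 1) / 2, by omega⟩ ?_
    have hsub : G ⊆ Finset.univ.filter fun k => ‖x j - x k‖ ≤ 2 * r := by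
      intro k hk
      simp only [Finset.mem_filter, Finset.mem_univ, true_and]
      have h1 := (hmem k).1 hk
      have h2 := (hmem j).1 hj
      have h3 := norm_sub_le (x j - c) (x k - c)
      rw [sub_sub_sub_cancel_right] at h3
      linarith
    have := Finset.card_le_card hsub
    simp only
    omega
  have hir := lt_card_of_sort_le (f := fun k => ‖x i - x k‖) ⟨(N - 1) / 2, by omega⟩
    ((hi j).trans hjr)
  simp only at hir
  set H := Finset.univ.filter fun k => ‖x i - x k‖ ≤ 2 * r with hH
  -- `G` has more than `N/2` elements and `H` at least `⌈N/2⌉`, so they meet: some good point lies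
  -- within `2r` of the aggregate.
  have hne : (G ∩ H).Nonempty := by
    refine Finset.inter_nonempty_of_card_lt_card_add_card (Finset.subset_univ G)
      (Finset.subset_univ H) ?_
    rw [Finset.card_univ, Fintype.card_fin]
    omega
  obtain ⟨k, hk⟩ := hne
  obtain ⟨hkG, hkH⟩ := Finset.mem_inter.1 hk
  have h1 := (hmem k).1 hkG
  have h2 : ‖x i - x k‖ ≤ 2 * r := by simpa [hH] using hkH
  have h3 := norm_add_le (x i - x k) (x k - c)
  rw [sub_add_sub_cancel] at h3
  linarith

end Aggregate

/-! ### Laws of the cycling iterates -/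

section Cyclic

variable {d N : ℕ} {step : Param d → Param d → Param d} {θ₀ : Param d}

theorem measurable_cyclicIterates {Ω : Type*} {m : MeasurableSpace Ω}
    (hstep : Measurable fun z : Param d × Param d => step z.1 z.2) {G : ℕ → Ω → Param d}
    (n : Fin N) (t : ℕ) (hG : ∀ s, s < t → s % N = n → Measurable (G s)) :
    Measurable fun ω => cyclicIterates N step θ₀ (fun s => G s ω) t n := by
  induction t with
  | zero => exact measurable_const
  | succ t ih =>
    have ih' := ih fun s hs => hG s (hs.trans t.lt_succ_self)
    by_cases h : t % N = n
    · simp only [cyclicIterates, h, if_true]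
      exact hstep.comp (ih'.prodMk (hG t t.lt_succ_self h))
    · simpa only [cyclicIterates, h, if_false] using ih'

theorem cyclicIterates_congr {g g' : ℕ → Param d} (n : Fin N) (t : ℕ)
    (h : ∀ s, s % N = n → g s = g' s) :
    cyclicIterates N step θ₀ g t n = cyclicIterates N step θ₀ g' t n := by
  induction t with
  | zero => rfl
  | succ t ih =>
    by_cases ht : t % N = n
    · simp only [cyclicIterates, ht, if_true, ih, h t ht]
    · simpa only [cyclicIterates, ht, if_false] using ih

/-- Every full cycle of length `N` updates each iterate once. This turns the budget `T` into a
number of steps per iterate. -/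
theorem div_le_count (n : Fin N) (T : ℕ) : T / N ≤ Nat.count (fun s => s % N = n) T := by
  have hN : 0 < N := n.pos
  have h := Nat.count_modEq_card T hN (n : ℕ)
  have e : (fun s => s ≡ n [MOD N]) = fun s => s % N = n := by
    funext s
    rw [Nat.ModEq, Nat.mod_eq_of_lt n.isLt]
  simp only [e] at h
  rw [h]
  exact Nat.le_add_right _ _

end Cyclic

section ConditionalLaw

variable {d : ℕ} {Ω : Type*} {m mΩ : MeasurableSpace Ω} {Pr : Measure Ω} [IsProbabilityMeasure Pr]

/-- A variable with conditional law `K Y` given a `σ`-algebra for which `Y` is measurable. -/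
theorem map_prodMk_eq_compProd {K : Kernel (Param d) (Param d)} [IsMarkovKernel K]
    (hm : m ≤ mΩ) {Y Z : Ω → Param d} (hY : Measurable[m] Y) (hZ : Measurable Z)
    (h : ∀ A, MeasurableSet A → Pr⟦Z ⁻¹' A | m⟧ =ᵐ[Pr] fun ω => (K (Y ω)).real A) :
    Pr.map (fun ω => (Y ω, Z ω)) = Pr.map Y ⊗ₘ K := by
  have hY' : Measurable Y := hY.mono hm le_rfl
  have : IsProbabilityMeasure (Pr.map fun ω => (Y ω, Z ω)) :=
    Measure.isProbabilityMeasure_map (hY'.prodMk hZ).aemeasurable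
  -- Rectangles suffice, and on `s ×ˢ t` the identity is the defining property of conditional
  -- expectation over `Y ⁻¹' s`.
  refine Measure.ext_prod fun {s t} hs ht => ?_
  rw [Measure.map_apply (hY'.prodMk hZ) (hs.prod ht), Measure.compProd_apply_prod hs ht,
    setLIntegral_map hs (K.measurable_coe ht) hY']
  have hpre : (fun ω => (Y ω, Z ω)) ⁻¹' s ×ˢ t = Z ⁻¹' t ∩ Y ⁻¹' s := by
    ext ω; simp [and_comm]
  have h1 : ∫ ω in Y ⁻¹' s, (K (Y ω)).real t ∂Pr = Pr.real (Z ⁻¹' t ∩ Y ⁻¹' s) := by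
    rw [← integral_congr_ae (ae_restrict_of_ae (h t ht)),
      setIntegral_condExp hm ((integrable_const (1 : ℝ)).indicator (hZ ht)) (hY hs),
      setIntegral_indicator (hZ ht)]
    simp [Set.inter_comm]
  have hmeas : Measurable fun ω => (K (Y ω)).real t :=
    ((K.measurable_coe ht).comp hY').ennreal_toReal
  have hint : Integrable (fun ω => (K (Y ω)).real t) (Pr.restrict (Y ⁻¹' s)) :=
    Integrable.of_bound (C := 1) hmeas.aestronglyMeasurable (Filter.Eventually.of_forall fun ω => by
      rw [Real.norm_of_nonneg measureReal_nonneg]; exact measureReal_le_one)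
  rw [hpre, ← ofReal_measureReal, ← h1, ofReal_integral_eq_lintegral_ofReal hint
    (Filter.Eventually.of_forall fun ω => measureReal_nonneg)]
  exact lintegral_congr fun ω => ofReal_measureReal

end ConditionalLaw

section Stream

variable {d N : ℕ} {Ω : Type*} [MeasurableSpace Ω] {Pr : Measure Ω}
  {η β p : ℝ} {DO DI : Kernel (Param d) (Param d)} [IsMarkovKernel DI]
  {θ₀ : Param d} {hN : 0 < N} {g : ℕ → Ω → Param d}

theorem IsCorruptedStream.measurable_cyclicIterates
    (hg : IsCorruptedStream Pr η DO DI β p θ₀ N hN g) (n : Fin N) (t : ℕ) :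
    Measurable fun ω => cyclicIterates N (qcStep DI β p) θ₀ (fun s => g s ω) t n :=
  QCSGD.measurable_cyclicIterates (measurable_qcStep DI β p) n t fun s _ _ => hg.measurable s

/-- Each iterate is a fixed measurable function of its own gradient sequence `k ↦ g (n + k * N)`,
and these sequences are independent. -/
theorem IsCorruptedStream.iIndepFun_cyclicIterates
    (hg : IsCorruptedStream Pr η DO DI β p θ₀ N hN g) (t : ℕ) :
    iIndepFun (fun (n : Fin N) ω =>
      cyclicIterates N (qcStep DI β p) θ₀ (fun s => g s ω) t n) Pr := by
  have h := hg.indep.comp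
    (fun n h => cyclicIterates N (qcStep DI β p) θ₀ (fun s => h (s / N)) t n) (fun n =>
      QCSGD.measurable_cyclicIterates (G := fun s (h : ℕ → Param d) => h (s / N))
        (measurable_qcStep DI β p) n t fun s _ _ => measurable_pi_apply _)
  convert h using 1
  -- Reading entry `s / N` gives the true gradient only at times `s ≡ n mod N`, the only times when
  -- iterate `n` looks at it.
  funext n ω
  refine cyclicIterates_congr n t fun s hs => ?_
  simp only
  rw [← hs, mul_comm, Nat.mod_add_div]

variable [IsProbabilityMeasure Pr] [IsMarkovKernel DO]

theorem map_compProd_corruptedGradient (hη0 : 0 ≤ η) (hη1 : η ≤ 1) (ν : Measure (Param d))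
    [IsProbabilityMeasure ν] :
    (ν ⊗ₘ corruptedGradient η DO DI).map (fun z => qcStep DI β p z.1 z.2)
      = ν.bind (qcKernel η DO DI β p) := by
  have : IsMarkovKernel (corruptedGradient η DO DI) :=
    ⟨isProbabilityMeasure_corruptedGradient hη0 hη1 DO DI⟩
  ext S hS
  rw [Measure.map_apply (measurable_qcStep DI β p) hS,
    Measure.compProd_apply (measurable_qcStep DI β p hS),
    Measure.bind_apply hS (Kernel.measurable _).aemeasurable]
  refine lintegral_congr fun θ => ?_
  have hstep : Measurable (qcStep DI β p θ) :=
    (measurable_qcStep DI β p).comp measurable_prodMk_left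
  have e : qcKernel η DO DI β p θ = (corruptedGradient η DO DI θ).map (qcStep DI β p θ) := rfl
  rw [e, Measure.map_apply hstep hS]
  rfl

/-- Idle times leave the iterate unchanged, so its law depends only on the number of its active
times. At an active time the iterate is measurable for the past of its own run, so the conditional
law of the gradient produces one application of the kernel. -/
theorem IsCorruptedStream.map_cyclicIterates (hη0 : 0 ≤ η) (hη1 : η ≤ 1)
    (hg : IsCorruptedStream Pr η DO DI β p θ₀ N hN g) (n : Fin N) (t : ℕ) :
    Pr.map (fun ω => cyclicIterates N (qcStep DI β p) θ₀ (fun s => g s ω) t n)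
      = lawAfter (qcKernel η DO DI β p) (Measure.dirac θ₀)
          (Nat.count (fun s => s % N = n) t) := by
  have : IsMarkovKernel (corruptedGradient η DO DI) :=
    ⟨isProbabilityMeasure_corruptedGradient hη0 hη1 DO DI⟩
  induction t with
  | zero =>
    simp [cyclicIterates, lawAfter_zero, Measure.map_const]
  | succ t ih =>
    by_cases h : t % N = n
    · have hn : n = activeRun N hN t := Fin.ext h.symm
      rw [Nat.count_succ, if_pos h, lawAfter_succ, ← ih]
      simp only [cyclicIterates, h, if_true]
      have hm : runPast N g t ≤ (inferInstance : MeasurableSpace Ω) :=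
        iSup₂_le fun s _ => (hg.measurable s).comap_le
      have hY : Measurable[runPast N g t]
          fun ω => cyclicIterates N (qcStep DI β p) θ₀ (fun s => g s ω) t n := by
        refine QCSGD.measurable_cyclicIterates (measurable_qcStep DI β p) n t fun s hs hsn => ?_
        have : MeasurableSpace.comap (g s) inferInstance ≤ runPast N g t :=
          le_iSup₂_of_le s (show s < t ∧ s % N = t % N from ⟨hs, hsn.trans h.symm⟩) le_rfl
        exact (comap_measurable (g s)).mono this le_rfl
      have hY' := hY.mono hm le_rfl
      have hlaw := map_prodMk_eq_compProd (Pr := Pr) (K := corruptedGradient η DO DI) hm hY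
        (hg.measurable t) (by rw [hn]; exact hg.law t)
      have hν : IsProbabilityMeasure
          (Pr.map fun ω => cyclicIterates N (qcStep DI β p) θ₀ (fun s => g s ω) t n) :=
        Measure.isProbabilityMeasure_map hY'.aemeasurable
      rw [← map_compProd_corruptedGradient hη0 hη1, ← hlaw,
        Measure.map_map (measurable_qcStep DI β p) (hY'.prodMk (hg.measurable t))]
      rfl
    · rw [Nat.count_succ, if_neg h, add_zero, ← ih]
      simp only [cyclicIterates, h, if_false]

end Stream

/-! ### Majority of independent events -/

/-- Hoeffding for indicators of mean at most `0.21`: reaching half of them requires an excess of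
`0.29 N`, of probability at most `exp(-2 · 0.29² N)`, and `2 · 0.29² ≥ 1/16`. -/
theorem measure_half_le_card_le {d N : ℕ} {Ω : Type*} [MeasurableSpace Ω] {Pr : Measure Ω}
    [IsProbabilityMeasure Pr] {X : Fin N → Ω → Param d} (hX : ∀ n, Measurable (X n))
    (hind : iIndepFun X Pr) {S : Set (Param d)} [DecidablePred (· ∈ S)] (hS : MeasurableSet S)
    (hle : ∀ n, Pr.real (X n ⁻¹' S) ≤ 21 / 100) :
    Pr.real {ω | N ≤ 2 * (Finset.univ.filter fun n => X n ω ∈ S).card}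
      ≤ Real.exp (-(N / 16)) := by
  rcases Nat.eq_zero_or_pos N with rfl | hN
  · simp
  set f : Param d → ℝ := S.indicator fun _ => 1 with hf
  have hfm : Measurable f := measurable_const.indicator hS
  have hint : ∀ n, ∫ ω, f (X n ω) ∂Pr = Pr.real (X n ⁻¹' S) := by
    intro n
    have : (fun ω => f (X n ω)) = (X n ⁻¹' S).indicator fun _ => 1 := rfl
    rw [this, integral_indicator (hX n hS)]
    simp
  have hsub : ∀ n ∈ Finset.univ, HasSubgaussianMGF
      (fun ω => f (X n ω) - ∫ ω, f (X n ω) ∂Pr) ((‖(1 : ℝ) - 0‖₊ / 2) ^ 2) Pr := fun n _ =>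
    hasSubgaussianMGF_of_mem_Icc (hfm.comp (hX n)).aemeasurable
      (Filter.Eventually.of_forall fun ω => by
        by_cases h : X n ω ∈ S <;> simp [hf, h])
  have hind' : iIndepFun (fun n ω => f (X n ω) - ∫ ω, f (X n ω) ∂Pr) Pr :=
    hind.comp (fun n x => f x - ∫ ω, f (X n ω) ∂Pr) fun n => hfm.sub_const _
  have h1 := HasSubgaussianMGF.measure_sum_ge_le_of_iIndepFun hind' hsub
    (ε := 29 / 100 * N) (by positivity)
  refine (measureReal_mono ?_).trans (h1.trans (Real.exp_le_exp.2 ?_))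
  · intro ω hω
    have hω' : (N : ℝ) ≤ 2 * (Finset.univ.filter fun n => X n ω ∈ S).card := by
      exact_mod_cast hω
    have h2 : ∑ n, f (X n ω) = (Finset.univ.filter fun n => X n ω ∈ S).card := by
      simp only [hf, Set.indicator_apply, Finset.sum_ite, Finset.sum_const, nsmul_eq_mul]
      simp
    have h3 : ∑ n, ∫ ω, f (X n ω) ∂Pr ≤ 21 / 100 * N := by
      calc _ ≤ ∑ _n : Fin N, (21 / 100 : ℝ) :=
            Finset.sum_le_sum fun n _ => (hint n).trans_le (hle n)
        _ = _ := by simp [mul_comm]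
    simp only [Set.mem_ofPred_eq]
    rw [Finset.sum_sub_distrib, h2]
    linarith
  · have hN' : (0 : ℝ) < N := by exact_mod_cast hN
    simp only [Finset.sum_const, Finset.card_univ, Fintype.card_fin, sub_zero, nnnorm_one,
      nsmul_eq_mul]
    push_cast
    rw [div_le_iff₀ (by positivity)]
    nlinarith

/-- The aggregate of cycling iterates is close to `θs` with high probability, if the chain
satisfies a drift inequality and converges geometrically. -/
theorem IsCorruptedStream.le_measure_aggregate {d : ℕ} {θs θ₀ : Param d} {η β p : ℝ}
    (hη0 : 0 ≤ η) (hη1 : η ≤ 1)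
    {DO DI : Kernel (Param d) (Param d)} [IsMarkovKernel DO] [IsMarkovKernel DI]
    {γ b r : ℝ} (hP : Drift (qcKernel η DO DI β p) θs γ b) (hγ0 : 0 < γ) (hγ1 : γ ≤ 1)
    (hb : 0 ≤ b) (hr : 0 < r) (hbr : b / γ / r ^ 2 ≤ 14 / 100)
    {π : Measure (Param d)} {M ρ : ℝ}
    (hπ : GeometricConvergence (qcKernel η DO DI β p) θs θ₀ π M ρ) {δ : ℝ} (hδ : 0 < δ)
    {N : ℕ} {hN : 0 < N} (hNδ : 16 * Real.log (1 / δ) ≤ N) {T : ℕ}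
    (hT : N * ⌈Real.log (15 * M * (1 + ‖θ₀ - θs‖ ^ 2)) / Real.log (1 / ρ)⌉₊ ≤ T)
    {Ω : Type*} [MeasurableSpace Ω] {Pr : Measure Ω} [IsProbabilityMeasure Pr]
    {g : ℕ → Ω → Param d} (hg : IsCorruptedStream Pr η DO DI β p θ₀ N hN g) :
    1 - δ ≤ Pr.real {ω | ∀ θhat : Param d,
      IsAggregate hN (cyclicIterates N (qcStep DI β p) θ₀ (fun t => g t ω) T) θhat →
        ‖θhat - θs‖ ≤ 3 * r} := by
  classical
  have := isMarkovKernel_qcKernel hη0 hη1 DO DI β p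
  obtain ⟨S, hS⟩ : ∃ S : Set (Param d), S = {y | r ≤ ‖y - θs‖} := ⟨_, rfl⟩
  have hSm : MeasurableSet S := hS ▸ measurableSet_le_norm_sub θs r
  obtain ⟨X, hXdef⟩ : ∃ X : Fin N → Ω → Param d, X = fun n ω =>
    cyclicIterates N (qcStep DI β p) θ₀ (fun s => g s ω) T n := ⟨_, rfl⟩
  have hX : ∀ n, Measurable (X n) := fun n => hXdef ▸ hg.measurable_cyclicIterates n T
  have hle : ∀ n, Pr.real (X n ⁻¹' S) ≤ 21 / 100 := by
    intro n
    have h1 := hP.measure_lawAfter_le_of_geometricConvergence hγ0 hγ1 hb hπ hr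
      (((Nat.le_div_iff_mul_le hN).2 (by rwa [mul_comm])).trans (div_le_count n T))
    have h2 := hg.map_cyclicIterates hη0 hη1 n T
    rw [← hS, ← h2, map_measureReal_apply (hg.measurable_cyclicIterates n T) hSm] at h1
    rw [hXdef]
    linarith only [h1, hbr]
  have hind : iIndepFun X Pr := hXdef ▸ hg.iIndepFun_cyclicIterates T
  have hbad := measure_half_le_card_le hX hind hSm hle
  set F : Set Ω := {ω | N ≤ 2 * (Finset.univ.filter fun n => X n ω ∈ S).card} with hF
  have hexp : Real.exp (-(N / 16)) ≤ δ := by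
    rw [one_div, Real.log_inv] at hNδ
    rw [← Real.le_log_iff_exp_le hδ]
    linarith only [hNδ]
  have hFm : MeasurableSet F := by
    have : Measurable fun ω => (Finset.univ.filter fun n => X n ω ∈ S).card := by
      simp only [Finset.card_filter]
      exact Finset.measurable_sum _ fun n _ =>
        Measurable.ite (hX n hSm) measurable_const measurable_const
    exact measurableSet_le measurable_const (this.const_mul 2)
  have hcompl : Pr.real Fᶜ = 1 - Pr.real F := probReal_compl_eq_one_sub hFm
  -- The target event quantifies over all aggregates and need not be measurable; complements are
  -- taken only for `F`.
  have hsub : Pr.real Fᶜ ≤ Pr.real {ω | ∀ θhat : Param d,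
      IsAggregate hN (cyclicIterates N (qcStep DI β p) θ₀ (fun t => g t ω) T) θhat →
        ‖θhat - θs‖ ≤ 3 * r} := by
    refine measureReal_mono fun ω hω θhat hagg => hagg.norm_sub_le_three_mul hN ?_
    have hXω : cyclicIterates N (qcStep DI β p) θ₀ (fun t => g t ω) T = fun n => X n ω := by
      rw [hXdef]
    rw [hXω]
    beta_reduce
    have h1 : 2 * (Finset.univ.filter fun n => X n ω ∈ S).card < N := not_le.1 hω
    have h2 := Finset.card_filter_add_card_filter_not (s := (Finset.univ : Finset (Fin N)))
      (fun n => X n ω ∈ S)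
    rw [Finset.card_univ, Fintype.card_fin] at h2
    have h3 : (Finset.univ.filter fun n => ¬ X n ω ∈ S).card
        ≤ (Finset.univ.filter fun n => ‖X n ω - θs‖ ≤ r).card := by
      refine Finset.card_le_card (Finset.monotone_filter_right _ fun n _ hn => ?_)
      rw [hS] at hn
      exact (not_le.1 hn).le
    omega
  refine le_trans ?_ (hcompl.symm.le.trans hsub)
  linarith only [hbad, hexp]

/-! ### Harris' theorem -/

section Harris

variable {X : Type*}

/-- `φ` oscillates by at most `C` times the weighted distance `2 + a V x + a V y`. -/
def OscBound (V : X → ℝ) (a C : ℝ) (φ : X → ℝ) : Prop :=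
  ∀ x y, |φ x - φ y| ≤ C * (2 + a * V x + a * V y)

/-- The weighted oscillation is a weighted sup norm modulo constants; the best upper shift is the
infimum of `C (1 + a V) - φ`, finite because `φ` is bounded. The contraction argument can then use
pointwise bounds. -/
theorem OscBound.exists_shift {V φ : X → ℝ} {a C B : ℝ} (ha : 0 ≤ a) (hC : 0 ≤ C)
    (hV : ∀ x, 0 ≤ V x) (hφ : ∀ x, |φ x| ≤ B) (h : OscBound V a C φ) :
    ∃ c, ∀ x, |φ x + c| ≤ C * (1 + a * V x) := by
  refine ⟨⨅ x, (C * (1 + a * V x) - φ x), fun y => ?_⟩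
  have : Nonempty X := ⟨y⟩
  have hbdd : BddBelow (Set.range fun x => C * (1 + a * V x) - φ x) := by
    refine ⟨-B, ?_⟩
    rintro _ ⟨x, rfl⟩
    have h1 := le_of_abs_le (hφ x)
    have h2 : 0 ≤ C * (1 + a * V x) := mul_nonneg hC (by have := mul_nonneg ha (hV x); linarith)
    simp only
    linarith
  have h1 := ciInf_le hbdd y
  have h2 : -(C * (1 + a * V y)) - φ y ≤ ⨅ x, (C * (1 + a * V x) - φ x) := by
    refine le_ciInf fun x => ?_
    have := le_of_abs_le (h x y)
    linarith
  rw [abs_le]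
  constructor <;> linarith

variable [MeasurableSpace X] {Q : Kernel X X} {V : X → ℝ} {l K : ℝ}

theorem integrable_of_lyapunov (hVm : Measurable V) (hV : ∀ x, 0 ≤ V x) {x : X}
    (hQ : ∫⁻ y, ENNReal.ofReal (V y) ∂(Q x) ≤ ENNReal.ofReal (l * V x + K)) :
    Integrable V (Q x) :=
  lintegral_ofReal_ne_top_iff_integrable hVm.aestronglyMeasurable
    (Filter.Eventually.of_forall hV) |>.1 (hQ.trans_lt ENNReal.ofReal_lt_top).ne

theorem integral_le_of_lyapunov (hVm : Measurable V) (hV : ∀ x, 0 ≤ V x) (hl : 0 ≤ l)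
    (hK : 0 ≤ K) {x : X}
    (hQ : ∫⁻ y, ENNReal.ofReal (V y) ∂(Q x) ≤ ENNReal.ofReal (l * V x + K)) :
    ∫ y, V y ∂(Q x) ≤ l * V x + K := by
  rw [← ofReal_integral_eq_lintegral_ofReal (integrable_of_lyapunov hVm hV hQ)
    (Filter.Eventually.of_forall hV)] at hQ
  have := mul_nonneg hl (hV x)
  exact (ENNReal.ofReal_le_ofReal_iff (by positivity)).1 hQ

variable [IsMarkovKernel Q]

/-- Lyapunov drift and a minorization on a sublevel set of `V` make `Q` contract weighted
oscillations. -/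
theorem exists_oscBound_contraction (hVm : Measurable V) (hV : ∀ x, 0 ≤ V x) (hl0 : 0 ≤ l)
    (hl1 : l < 1) (hK : 0 < K)
    (hQ : ∀ x, ∫⁻ y, ENNReal.ofReal (V y) ∂(Q x) ≤ ENNReal.ofReal (l * V x + K))
    {α : ℝ} (hα0 : 0 < α) {ν : Measure X} [IsProbabilityMeasure ν]
    (hmin : ∀ x, V x ≤ 4 * K / (1 - l) → ENNReal.ofReal α • ν ≤ Q x) :
    ∃ a r : ℝ, 0 < a ∧ 0 < r ∧ r < 1 ∧ ∀ (φ : X → ℝ) (B C : ℝ), Measurable φ → (∀ x, |φ x| ≤ B) →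
      0 ≤ C → OscBound V a C φ → OscBound V a (r * C) fun x => ∫ y, φ y ∂(Q x) := by
  -- This weight makes the drift cost `2aK` equal to `α`, half of the gain `2α` from the
  -- minorization.
  set a := α / (2 * K) with ha
  have ha0 : 0 < a := by positivity
  have haK : 2 * (a * K) = α := by rw [ha]; field_simp
  have hl' : 0 < 1 - l := by linarith
  set R := 4 * K / (1 - l) with hR
  have hR0 : 0 < R := by positivity
  have hRK : 4 * K = R * (1 - l) := by rw [hR]; field_simp
  set r₁ := (2 + a * ((1 + l) / 2) * R) / (2 + a * R) with hr₁
  have hr₁' : r₁ * (2 + a * R) = 2 + a * ((1 + l) / 2) * R := by rw [hr₁]; field_simp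
  have haR : 0 < a * R := by positivity
  have hr₁1 : r₁ < 1 := by
    rw [hr₁, div_lt_one (by positivity)]
    nlinarith
  set r := max r₁ (max (1 - α / 2) l) with hr
  have hrr₁ : r₁ ≤ r := le_max_left _ _
  have hrα : 1 - α / 2 ≤ r := (le_max_left _ _).trans (le_max_right _ _)
  have hrl : l ≤ r := (le_max_right _ _).trans (le_max_right _ _)
  have hr₁0 : 0 < r₁ := by positivity
  refine ⟨a, r, ha0, hr₁0.trans_le hrr₁, max_lt hr₁1 (max_lt (by linarith) hl1), ?_⟩
  intro φ B C hφm hφ hC hosc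
  obtain ⟨c, hc⟩ := hosc.exists_shift ha0.le hC hV hφ
  set W : X → ℝ := fun x => C * (1 + a * V x) with hW
  have iV : ∀ x, Integrable V (Q x) := fun x => integrable_of_lyapunov hVm hV (hQ x)
  have iφ : ∀ x, Integrable φ (Q x) := fun x =>
    Integrable.of_bound (C := B) hφm.aestronglyMeasurable (Filter.Eventually.of_forall hφ)
  have iW : ∀ x, Integrable W (Q x) := fun x =>
    ((integrable_const _).add ((iV x).const_mul a)).const_mul C
  have iφc : ∀ x, Integrable (fun y => φ y + c) (Q x) := fun x =>
    (iφ x).add (integrable_const c)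
  have eφc : ∀ x, ∫ y, (φ y + c) ∂(Q x) = ∫ y, φ y ∂(Q x) + c := fun x => by
    rw [integral_add (iφ x) (integrable_const c)]; simp
  have hWle : ∀ x, ∫ y, W y ∂(Q x) ≤ C * (1 + a * (l * V x + K)) := by
    intro x
    simp only [hW]
    rw [integral_const_mul, integral_add (integrable_const _) ((iV x).const_mul a),
      integral_const_mul]
    have := integral_le_of_lyapunov hVm hV hl0 hK.le (hQ x)
    have := mul_le_mul_of_nonneg_left this ha0.le
    simp only [integral_const, probReal_univ, smul_eq_mul, one_mul]
    gcongr
  have hkey : ∀ x y, ∫ z, φ z ∂(Q x) - ∫ z, φ z ∂(Q y) ≤ r * C * (2 + a * V x + a * V y) := by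
    intro x y
    have hS : 0 ≤ a * V x + a * V y :=
      add_nonneg (mul_nonneg ha0.le (hV x)) (mul_nonneg ha0.le (hV y))
    suffices h : ∃ s, ∫ z, φ z ∂(Q x) - ∫ z, φ z ∂(Q y) ≤ C * s
        ∧ s ≤ r * (2 + a * V x + a * V y) by
      obtain ⟨s, h1, h2⟩ := h
      calc _ ≤ C * s := h1
        _ ≤ C * (r * (2 + a * V x + a * V y)) := mul_le_mul_of_nonneg_left h2 hC
        _ = _ := by ring
    -- If both points are low, the minorization gives the contraction; otherwise the drift alone
    -- does.
    by_cases hxy : V x + V y ≤ R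
    · have hx : ENNReal.ofReal α • ν ≤ Q x := hmin x (by linarith [hV y])
      have hy : ENNReal.ofReal α • ν ≤ Q y := hmin y (by linarith [hV x])
      have iφν : Integrable (fun y => φ y + c) (ENNReal.ofReal α • ν) := (iφc x).mono_measure hx
      have iWν : Integrable W (ENNReal.ofReal α • ν) := (iW x).mono_measure hx
      -- `W - (φ + c)` and `W + (φ + c)` are nonnegative, so their integrals only decrease when `Q
      -- x`, `Q y` are replaced by the common part `α ν`. On adding, `φ` cancels there and leaves `2
      -- ∫ W ≥ 2C` times `α`.
      have h1 := integral_mono_measure (f := fun z => W z - (φ z + c)) hx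
        (Filter.Eventually.of_forall fun z => sub_nonneg.2 (le_of_abs_le (hc z)))
        ((iW x).sub (iφc x))
      have h2 := integral_mono_measure (f := fun z => W z + (φ z + c)) hy
        (Filter.Eventually.of_forall fun z => by
          have := neg_le_of_abs_le (hc z)
          simp only [Pi.zero_apply]
          linarith)
        ((iW y).add (iφc y))
      rw [integral_sub (iW x) (iφc x), integral_sub iWν iφν, eφc] at h1
      rw [integral_add (iW y) (iφc y), integral_add iWν iφν, eφc] at h2
      have h3 : C * α ≤ ∫ z, W z ∂(ENNReal.ofReal α • ν) := by
        have iWν' : Integrable W ν :=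
          (integrable_smul_measure (by simpa using hα0) ENNReal.ofReal_ne_top).1 iWν
        rw [integral_smul_measure, ENNReal.toReal_ofReal hα0.le, smul_eq_mul, mul_comm]
        refine mul_le_mul_of_nonneg_left ?_ hα0.le
        calc C = ∫ _, C ∂ν := by simp
          _ ≤ ∫ z, W z ∂ν := integral_mono (integrable_const _) iWν' fun z =>
            le_mul_of_one_le_right hC (by have := mul_nonneg ha0.le (hV z); linarith)
      refine ⟨2 - 2 * α + l * (a * V x + a * V y) + 2 * (a * K), ?_, ?_⟩
      · have := hWle x
        have := hWle y
        linarith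
      · rw [haK]
        have := mul_le_mul_of_nonneg_right hrl hS
        linarith
    · have h1 : ∫ z, (φ z + c) ∂(Q x) ≤ ∫ z, W z ∂(Q x) :=
        integral_mono (iφc x) (iW x) fun z => le_of_abs_le (hc z)
      have h2 : ∫ z, -(φ z + c) ∂(Q y) ≤ ∫ z, W z ∂(Q y) :=
        integral_mono (iφc y).neg (iW y) fun z => (neg_le_abs _).trans (hc z)
      rw [integral_neg, eφc] at h2
      rw [eφc] at h1
      refine ⟨2 + l * (a * V x + a * V y) + 2 * (a * K), ?_, ?_⟩
      · have := hWle x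
        have := hWle y
        linarith
      · have h3 : 4 * K ≤ (V x + V y) * (1 - l) := by
          rw [hRK]; exact mul_le_mul_of_nonneg_right (not_le.1 hxy).le hl'.le
        have h4 := mul_le_mul_of_nonneg_left h3 ha0.le
        -- The ratio of `2 + (1 + l)/2 · s` to `2 + s` decreases in `s`, and `r₁` is its value at `s
        -- = a R`.
        have h5 : 2 + (1 + l) / 2 * (a * V x + a * V y) ≤ r₁ * (2 + a * V x + a * V y) := by
          have h6 : a * R ≤ a * V x + a * V y := by
            rw [← mul_add]; exact mul_le_mul_of_nonneg_left (not_le.1 hxy).le ha0.le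
          have h7 : 2 * (1 - r₁) = a * R * (r₁ - (1 + l) / 2) := by linarith
          have h8 : 0 ≤ r₁ - (1 + l) / 2 := by
            by_contra hneg
            have := mul_neg_of_pos_of_neg haR (not_le.1 hneg)
            linarith
          have := mul_le_mul_of_nonneg_right h6 h8
          linarith
        have h9 := mul_le_mul_of_nonneg_right hrr₁ (by linarith : 0 ≤ 2 + a * V x + a * V y)
        linarith
  intro x y
  rw [abs_le]
  constructor
  · have := hkey y x
    linarith
  · exact hkey x y

instance isMarkovKernel_pow (P : Kernel X X) [IsMarkovKernel P] (n : ℕ) :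
    IsMarkovKernel (P ^ n) := by
  induction n with
  | zero => exact inferInstanceAs (IsMarkovKernel (Kernel.id : Kernel X X))
  | succ n ih => exact inferInstanceAs (IsMarkovKernel ((P ^ n) ∘ₖ P))

theorem real_pow_add (P : Kernel X X) [IsMarkovKernel P] (m n : ℕ) (x : X) {S : Set X}
    (hS : MeasurableSet S) : ((P ^ (m + n)) x).real S = ∫ y, ((P ^ n) y).real S ∂((P ^ m) x) := by
  have hm : Measurable fun y => (P ^ n) y S := Kernel.measurable_coe _ hS
  simp only [Measure.real]
  rw [Kernel.pow_add_apply_eq_lintegral P m n x hS,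
    integral_toReal hm.aemeasurable (Filter.Eventually.of_forall fun y => measure_lt_top _ _)]

theorem measurable_real_kernel (P : Kernel X X) {S : Set X} (hS : MeasurableSet S) :
    Measurable fun y => (P y).real S :=
  (P.measurable_coe hS).ennreal_toReal

/-- Geometric loss of memory of a chain some power of which satisfies the hypotheses of Harris'
theorem. -/
theorem exists_geometric_forgetting {P : Kernel X X} [IsMarkovKernel P] {m : ℕ} (hm : 0 < m)
    (hVm : Measurable V) (hV : ∀ x, 0 ≤ V x) (hl0 : 0 ≤ l) (hl1 : l < 1) (hK : 0 < K)
    (hQ : ∀ x, ∫⁻ y, ENNReal.ofReal (V y) ∂((P ^ m) x) ≤ ENNReal.ofReal (l * V x + K))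
    {α : ℝ} (hα0 : 0 < α) {ν : Measure X} [IsProbabilityMeasure ν]
    (hmin : ∀ x, V x ≤ 4 * K / (1 - l) → ENNReal.ofReal α • ν ≤ (P ^ m) x) :
    ∃ a C ρ : ℝ, 0 < a ∧ 0 < C ∧ 0 < ρ ∧ ρ < 1 ∧ ∀ (t : ℕ) (S : Set X), MeasurableSet S →
      OscBound V a (C * ρ ^ t) fun x => ((P ^ t) x).real S := by
  obtain ⟨a, r, ha, hr0, hr1, hcontr⟩ :=
    exists_oscBound_contraction (Q := P ^ m) hVm hV hl0 hl1 hK hQ hα0 hmin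
  have hm' : (0 : ℝ) < m := by exact_mod_cast hm
  have hiter : ∀ (j k : ℕ) (S : Set X), MeasurableSet S →
      OscBound V a (r ^ k) fun x => ((P ^ (m * k + j)) x).real S := by
    intro j k S hS
    induction k with
    | zero =>
      intro x y
      have h1 := abs_real_sub_le_one (μ := (P ^ (m * 0 + j)) x) (ν := (P ^ (m * 0 + j)) y) S
      have h2 := mul_nonneg ha.le (hV x)
      have h3 := mul_nonneg ha.le (hV y)
      rw [pow_zero, one_mul]
      linarith
    | succ k ih =>
      have h1 := hcontr _ 1 _ (measurable_real_kernel _ hS) (fun x => by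
        rw [abs_of_nonneg measureReal_nonneg]; exact measureReal_le_one) (by positivity) ih
      rw [← pow_succ'] at h1
      have e : m * (k + 1) + j = m + (m * k + j) := by ring
      simpa only [e, real_pow_add P m (m * k + j) _ hS] using h1
  -- The prefactor `r⁻¹` pays for rounding `t / m` down.
  refine ⟨a, r⁻¹, r ^ (1 / (m : ℝ)), ha, inv_pos.2 hr0, by positivity,
    Real.rpow_lt_one hr0.le hr1 (by positivity), fun t S hS x y => ?_⟩
  have h1 := hiter (t % m) (t / m) S hS x y
  rw [Nat.div_add_mod] at h1
  refine h1.trans (mul_le_mul_of_nonneg_right ?_ ?_)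
  · rw [← Real.rpow_natCast (r ^ (1 / (m : ℝ))), ← Real.rpow_mul hr0.le, ← Real.rpow_neg_one,
      ← Real.rpow_add hr0, ← Real.rpow_natCast]
    refine Real.rpow_le_rpow_of_exponent_ge hr0 hr1.le ?_
    have h2 : (t : ℝ) < m * ((t / m : ℕ) + 1) := by exact_mod_cast Nat.lt_mul_div_succ t hm
    have h3 : 1 / (m : ℝ) * t < (t / m : ℕ) + 1 := by
      rw [one_div, inv_mul_lt_iff₀ hm']; exact h2
    linarith
  · have h2 := mul_nonneg ha.le (hV x)
    have h3 := mul_nonneg ha.le (hV y)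
    linarith

end Harris

/-! ### Limits of measures in total variation -/

section Limit

variable {X : Type*} [MeasurableSpace X]

/-- A sequence of probability measures which is Cauchy in total variation has a limit. -/
theorem exists_limit_measure {μ : ℕ → Measure X} [∀ t, IsProbabilityMeasure (μ t)] {e : ℕ → ℝ}
    (he : Filter.Tendsto e Filter.atTop (nhds 0))
    (h : ∀ s t (S : Set X), MeasurableSet S → |(μ (t + s)).real S - (μ t).real S| ≤ e t) :
    ∃ π : Measure X, IsProbabilityMeasure π ∧
      ∀ t (S : Set X), MeasurableSet S → |(μ t).real S - π.real S| ≤ e t := by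
  have hlim : ∀ S : Set X, ∃ l : ℝ, MeasurableSet S →
      Filter.Tendsto (fun t => (μ t).real S) Filter.atTop (nhds l) := by
    intro S
    by_cases hS : MeasurableSet S
    · have hc : CauchySeq fun t => (μ t).real S := by
        refine cauchySeq_of_le_tendsto_0 (fun t => 2 * e t) (fun n m N hn hm => ?_) ?_
        · have h1 := h (n - N) N S hS
          have h2 := h (m - N) N S hS
          rw [Nat.add_sub_cancel' hn] at h1
          rw [Nat.add_sub_cancel' hm] at h2
          rw [Real.dist_eq]
          calc _ = |((μ n).real S - (μ N).real S) - ((μ m).real S - (μ N).real S)| := by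
                congr 1; ring
            _ ≤ _ := abs_sub _ _
            _ ≤ 2 * e N := by linarith
        · simpa using he.const_mul 2
      obtain ⟨l, hl⟩ := cauchySeq_tendsto_of_complete hc
      exact ⟨l, fun _ => hl⟩
    · exact ⟨0, fun h => absurd h hS⟩
  choose F hF using hlim
  have hF0 : ∀ S, MeasurableSet S → 0 ≤ F S := fun S hS =>
    ge_of_tendsto' (hF S hS) fun t => measureReal_nonneg
  have herr : ∀ t (S : Set X), MeasurableSet S → |(μ t).real S - F S| ≤ e t := by
    intro t S hS
    have h1 : Filter.Tendsto (fun s => |(μ (t + s)).real S - (μ t).real S|) Filter.atTop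
        (nhds |F S - (μ t).real S|) := by
      have := (hF S hS).comp (Filter.tendsto_add_atTop_nat t)
      simp only [Function.comp_def, add_comm _ t] at this
      exact (this.sub_const _).abs
    rw [abs_sub_comm]
    exact le_of_tendsto' h1 fun s => h s t S hS
  have hsum : ∀ f : ℕ → Set X, (∀ i, MeasurableSet (f i)) → Pairwise (Function.onFun Disjoint f) →
      HasSum (fun i => F (f i)) (F (⋃ i, f i)) := by
    intro f hf hdis
    have hU : MeasurableSet (⋃ i, f i) := MeasurableSet.iUnion hf
    have hpart : ∀ s : Finset ℕ, ∑ i ∈ s, F (f i) = F (⋃ i ∈ s, f i) := by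
      intro s
      have hs : MeasurableSet (⋃ i ∈ s, f i) := Finset.measurableSet_biUnion s fun i _ => hf i
      refine tendsto_nhds_unique ?_ (hF _ hs)
      have := tendsto_finsetSum s fun i _ => hF (f i) (hf i)
      refine this.congr fun t => ?_
      rw [measureReal_biUnion_finset (fun i _ j _ hij => hdis hij) fun i _ => hf i]
    rw [HasSum]
    simp only [hpart]
    -- Countable additivity passes to the limit because the error `e t` is uniform over sets: fix
    -- `t` with `e t < ε/3`, then use additivity of `μ t`.
    rw [Metric.tendsto_nhds]
    intro ε hε
    obtain ⟨t, ht⟩ := (he.eventually (gt_mem_nhds (by positivity : 0 < ε / 3))).exists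
    have hμ : HasSum (fun i => (μ t).real (f i)) ((μ t).real (⋃ i, f i)) := by
      have h1 := measure_iUnion hdis hf (μ := μ t)
      have h2 := ENNReal.hasSum_toReal (f := fun i => μ t (f i))
        (by rw [← h1]; exact measure_ne_top _ _)
      rwa [← ENNReal.tsum_toReal_eq (fun i => measure_ne_top _ _), ← h1] at h2
    have hμ' := (Metric.tendsto_nhds.1 hμ) (ε / 3) (by positivity)
    filter_upwards [hμ'] with s hs
    have hsm : MeasurableSet (⋃ i ∈ s, f i) := Finset.measurableSet_biUnion s fun i _ => hf i
    rw [← measureReal_biUnion_finset (fun i _ j _ hij => hdis hij) fun i _ => hf i,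
      Real.dist_eq] at hs
    have h1 := herr t _ hsm
    have h2 := herr t _ hU
    rw [Real.dist_eq]
    rw [abs_le] at h1 h2
    rw [abs_lt] at hs ⊢
    constructor <;> linarith
  have hFe : F ∅ = 0 := tendsto_nhds_unique (hF ∅ MeasurableSet.empty) (by simp)
  have hFu : F Set.univ = 1 := tendsto_nhds_unique (hF _ MeasurableSet.univ) (by simp)
  let π : Measure X := Measure.ofMeasurable (fun S _ => ENNReal.ofReal (F S)) (by simp [hFe])
    (fun f hf hdis => by
      have h1 := hsum f hf hdis
      rw [← h1.tsum_eq, ENNReal.ofReal_tsum_of_nonneg (fun i => hF0 _ (hf i)) h1.summable])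
  have hπ : ∀ S, MeasurableSet S → π S = ENNReal.ofReal (F S) := fun S hS =>
    Measure.ofMeasurable_apply S hS
  refine ⟨π, ⟨by rw [hπ _ MeasurableSet.univ, hFu, ENNReal.ofReal_one]⟩, fun t S hS => ?_⟩
  rw [measureReal_def π, hπ S hS, ENNReal.toReal_ofReal (hF0 S hS)]
  exact herr t S hS

/-- Measures that are close on all measurable sets have close integrals of functions with values
in `[0, 1]`. -/
theorem abs_integral_sub_le {μ ν : Measure X} [IsProbabilityMeasure μ] [IsProbabilityMeasure ν]
    {e : ℝ} (h : ∀ S, MeasurableSet S → |μ.real S - ν.real S| ≤ e) {f : X → ℝ}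
    (hf : Measurable f) (hf0 : ∀ x, 0 ≤ f x) (hf1 : ∀ x, f x ≤ 1) :
    |∫ x, f x ∂μ - ∫ x, f x ∂ν| ≤ e := by
  -- Layer cake: the integral is an average of measures of superlevel sets over `[0, 1]`, so the
  -- error stays `e` without a factor two.
  have key : ∀ μ : Measure X, IsProbabilityMeasure μ →
      ∫ x, f x ∂μ = ∫ t in (0 : ℝ)..1, μ.real {x | t < f x} := by
    intro μ hμ
    have hint : Integrable f μ := Integrable.of_bound (C := 1) hf.aestronglyMeasurable
      (Filter.Eventually.of_forall fun x => by rw [Real.norm_of_nonneg (hf0 x)]; exact hf1 x)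
    rw [hint.integral_eq_integral_meas_lt (Filter.Eventually.of_forall hf0),
      intervalIntegral.integral_of_le zero_le_one]
    refine setIntegral_eq_of_subset_of_forall_sdiff_eq_zero measurableSet_Ioi
      Set.Ioc_subset_Ioi_self fun t ht => ?_
    have ht1 : 1 < t := by
      by_contra hle
      exact ht.2 ⟨ht.1, not_lt.1 hle⟩
    have : {x | t < f x} = ∅ := by
      ext x
      simpa using (hf1 x).trans ht1.le
    rw [this, measureReal_empty]
  have hanti : ∀ μ : Measure X, IsProbabilityMeasure μ →
      IntervalIntegrable (fun t => μ.real {x | t < f x}) volume 0 1 := by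
    intro μ hμ
    refine Antitone.intervalIntegrable fun s t hst => measureReal_mono fun x hx => ?_
    exact lt_of_le_of_lt hst hx
  rw [key μ inferInstance, key ν inferInstance,
    ← intervalIntegral.integral_sub (hanti μ inferInstance) (hanti ν inferInstance)]
  have := intervalIntegral.norm_integral_le_of_norm_le_const (a := (0 : ℝ)) (b := 1)
    (f := fun t => μ.real {x | t < f x} - ν.real {x | t < f x}) (C := e) fun t _ =>
      h _ (measurableSet_lt measurable_const hf)
  simpa using this

end Limit

/-! ### Existence and uniqueness of the limit law -/

section Existence

variable {d : ℕ} {P : Kernel (Param d) (Param d)}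

theorem lawAfter_dirac (P : Kernel (Param d) (Param d)) (x : Param d) (t : ℕ) :
    lawAfter P (Measure.dirac x) t = (P ^ t) x := by
  induction t with
  | zero => rw [lawAfter_zero, pow_zero]; exact (Kernel.id_apply x).symm
  | succ t ih => rw [lawAfter_succ, ih, pow_succ']; exact (Kernel.comp_apply P (P ^ t) x).symm

theorem bind_pow_of_invariant {π : Measure (Param d)} (h : Kernel.Invariant P π) (t : ℕ) :
    π.bind (P ^ t) = π := by
  induction t with
  | zero => rw [pow_zero]; exact Measure.bind_dirac
  | succ t ih =>
    have e : (⇑(P ^ (t + 1)) : Param d → Measure (Param d)) = fun x => ((P ^ t) x).bind P := by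
      funext x
      rw [pow_succ']
      exact Kernel.comp_apply P (P ^ t) x
    rw [e, ← Measure.bind_bind (P ^ t).measurable.aemeasurable P.measurable.aemeasurable, ih]
    exact h

variable [IsMarkovKernel P]

theorem real_bind (P : Kernel (Param d) (Param d)) [IsMarkovKernel P] (ν : Measure (Param d))
    {S : Set (Param d)} (hS : MeasurableSet S) :
    (ν.bind P).real S = ∫ x, (P x).real S ∂ν := by
  simp only [Measure.real]
  rw [Measure.bind_apply hS P.measurable.aemeasurable,
    integral_toReal (P.measurable_coe hS).aemeasurable
      (Filter.Eventually.of_forall fun y => measure_lt_top _ _)]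

variable {θs : Param d} {γ b : ℝ}

/-- Harris' theorem for a chain that contracts the mean squared distance to a point, with a
multi-step minorization on a large ball. -/
theorem Drift.exists_geometricConvergence (hP : Drift P θs γ b) (hγ0 : 0 < γ) (hγ1 : γ ≤ 1)
    (hb : 0 < b) {m : ℕ} (hm : 0 < m) {α : ℝ} (hα : 0 < α) {ν : Measure (Param d)}
    [IsProbabilityMeasure ν]
    (hmin : ∀ x, ‖x - θs‖ ^ 2 ≤ 4 * (b / γ) / γ → ENNReal.ofReal α • ν ≤ (P ^ m) x)
    (θ₀ : Param d) :
    ∃ π : Measure (Param d),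
      (∀ π' : Measure (Param d), IsProbabilityMeasure π' → Kernel.Invariant P π' → π' = π) ∧
      ∃ M ρ : ℝ, GeometricConvergence P θs θ₀ π M ρ := by
  have hVm : Measurable fun x : Param d => ‖x - θs‖ ^ 2 := by fun_prop
  have hV : ∀ x : Param d, 0 ≤ ‖x - θs‖ ^ 2 := fun x => by positivity
  have hmom : ∀ (x : Param d) (t : ℕ), ∫⁻ y, ENNReal.ofReal (‖y - θs‖ ^ 2) ∂((P ^ t) x)
      ≤ ENNReal.ofReal ((1 - γ) ^ t * ‖x - θs‖ ^ 2 + b / γ) := by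
    intro x t
    rw [← lawAfter_dirac]
    exact hP.lintegral_lawAfter_le hγ0 hγ1 hb.le x t
  obtain ⟨a, C, ρ, ha, hC, hρ0, hρ1, hosc⟩ := exists_geometric_forgetting (P := P)
    (V := fun x => ‖x - θs‖ ^ 2) (l := 1 - γ) (K := b / γ) hm hVm hV (by linarith) (by linarith)
    (by positivity) (fun x => (hmom x m).trans (ENNReal.ofReal_le_ofReal (by
      gcongr
      exact pow_le_of_le_one (by linarith) (by linarith) hm.ne'))) hα (ν := ν)
    (fun x hx => hmin x (by rwa [sub_sub_cancel] at hx))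
  set v := ‖θ₀ - θs‖ ^ 2 with hv
  have hv0 : 0 ≤ v := by positivity
  have hint : ∀ s, Integrable (fun y => ‖y - θs‖ ^ 2) ((P ^ s) θ₀) := fun s =>
    integrable_of_lyapunov (l := (1 - γ) ^ s) hVm hV (hmom θ₀ s)
  have hle : ∀ s, ∫ y, ‖y - θs‖ ^ 2 ∂((P ^ s) θ₀) ≤ v + b / γ := by
    intro s
    have h0 : 0 ≤ 1 - γ := by linarith
    refine (integral_le_of_lyapunov (Q := P ^ s) hVm hV (pow_nonneg h0 s)
      (by positivity) (hmom θ₀ s)).trans ?_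
    have : (1 - γ) ^ s * v ≤ 1 * v :=
      mul_le_mul_of_nonneg_right (pow_le_one₀ h0 (by linarith)) hv0
    linarith
  -- Average the oscillation bound between `θ₀` and a point distributed as the chain after `s`
  -- steps, whose mean `V` is at most `v + b / γ` for all `s`.
  set D := C * (2 + a * (v + b / γ) + a * v) with hD
  have hD0 : 0 < D := by positivity
  have hcauchy : ∀ s t (S : Set (Param d)), MeasurableSet S →
      |((P ^ (t + s)) θ₀).real S - ((P ^ t) θ₀).real S| ≤ D * ρ ^ t := by
    intro s t S hS
    have i1 : Integrable (fun y => ((P ^ t) y).real S) ((P ^ s) θ₀) :=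
      Integrable.of_bound (C := 1) (measurable_real_kernel _ hS).aestronglyMeasurable
        (Filter.Eventually.of_forall fun y => by
          rw [Real.norm_of_nonneg measureReal_nonneg]; exact measureReal_le_one)
    have e : ((P ^ (t + s)) θ₀).real S - ((P ^ t) θ₀).real S
        = ∫ y, (((P ^ t) y).real S - ((P ^ t) θ₀).real S) ∂((P ^ s) θ₀) := by
      rw [integral_sub i1 (integrable_const _), add_comm t s, real_pow_add P s t θ₀ hS]
      simp
    rw [e, ← Real.norm_eq_abs]
    have i3 : Integrable (fun y => 2 + a * ‖y - θs‖ ^ 2) ((P ^ s) θ₀) :=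
      (integrable_const _).add ((hint s).const_mul a)
    have i2 : Integrable (fun y => 2 + a * ‖y - θs‖ ^ 2 + a * v) ((P ^ s) θ₀) :=
      i3.add (integrable_const _)
    refine (norm_integral_le_of_norm_le (i2.const_mul (C * ρ ^ t))
      (Filter.Eventually.of_forall fun y => hosc t S hS y θ₀)).trans ?_
    rw [integral_const_mul, integral_add i3 (integrable_const _), integral_add (integrable_const _) ((hint s).const_mul a),
      integral_const_mul]
    simp only [integral_const, probReal_univ, smul_eq_mul, one_mul]
    calc _ ≤ C * ρ ^ t * (2 + a * (v + b / γ) + a * v) := by gcongr; exact hle s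
      _ = _ := by rw [hD]; ring
  have hρt : Filter.Tendsto (fun t : ℕ => ρ ^ t) Filter.atTop (nhds 0) :=
    tendsto_pow_atTop_nhds_zero_of_lt_one hρ0.le hρ1
  have he : Filter.Tendsto (fun t : ℕ => D * ρ ^ t) Filter.atTop (nhds 0) := by
    simpa using hρt.const_mul D
  obtain ⟨π, hπ, hπt⟩ := exists_limit_measure (μ := fun t => (P ^ t) θ₀) he hcauchy
  have hπlim : ∀ S, MeasurableSet S →
      Filter.Tendsto (fun t => ((P ^ t) θ₀).real S) Filter.atTop (nhds (π.real S)) := fun S hS =>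
    tendsto_iff_dist_tendsto_zero.2 (squeeze_zero (fun _ => dist_nonneg) (fun t => hπt t S hS) he)
  have hinv : Kernel.Invariant P π := by
    have := isProbabilityMeasure_bind P π
    refine Measure.ext fun S hS => (measureReal_eq_measureReal_iff).1 ?_
    rw [real_bind P π hS]
    have h1 : Filter.Tendsto (fun t => ∫ x, (P x).real S ∂((P ^ t) θ₀)) Filter.atTop
        (nhds (∫ x, (P x).real S ∂π)) :=
      tendsto_iff_dist_tendsto_zero.2 (squeeze_zero (fun _ => dist_nonneg)
        (fun t => abs_integral_sub_le (hπt t) (measurable_real_kernel P hS)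
          (fun _ => measureReal_nonneg) fun _ => measureReal_le_one) he)
    refine tendsto_nhds_unique h1 ?_
    have h2 := (hπlim S hS).comp (Filter.tendsto_add_atTop_nat 1)
    refine h2.congr fun t => ?_
    simp only [Function.comp_apply]
    rw [real_pow_add P t 1 θ₀ hS, pow_one]
  refine ⟨π, fun π' hπ' hinv' => ?_, D, ρ, hπ, hinv, hD0, hρ0, hρ1, fun t => ?_⟩
  -- Uniqueness: `P ^ t` forgets every starting point, so dominated convergence under `π'` suffices,
  -- without moments of `π'`.
  · refine Measure.ext fun S hS => (measureReal_eq_measureReal_iff).1 ?_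
    have h1 : ∀ t : ℕ, ∫ x, ((P ^ t) x).real S ∂π' = π'.real S := fun t => by
      rw [← real_bind (P ^ t) π' hS, bind_pow_of_invariant hinv']
    have h2 : ∀ y, Filter.Tendsto (fun t => ((P ^ t) y).real S) Filter.atTop
        (nhds (π.real S)) := by
      intro y
      have h3 : Filter.Tendsto (fun t => ((P ^ t) y).real S - ((P ^ t) θ₀).real S) Filter.atTop
          (nhds 0) := by
        refine squeeze_zero_norm (fun t => hosc t S hS y θ₀) ?_
        simpa using (hρt.const_mul C).mul_const (2 + a * ‖y - θs‖ ^ 2 + a * v)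
      simpa using h3.add (hπlim S hS)
    have h4 := tendsto_integral_of_dominated_convergence (μ := π') (fun _ => (1 : ℝ))
      (fun t => (measurable_real_kernel (P ^ t) hS).aestronglyMeasurable) (integrable_const _)
      (fun t => Filter.Eventually.of_forall fun y => by
        rw [Real.norm_of_nonneg measureReal_nonneg]; exact measureReal_le_one)
      (Filter.Eventually.of_forall h2)
    simp only [h1, integral_const, probReal_univ, smul_eq_mul, one_mul] at h4
    exact tendsto_nhds_unique tendsto_const_nhds h4
  · rw [lawAfter_dirac]
    have h1 : tvDist ((P ^ t) θ₀) π ≤ D * ρ ^ t := by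
      have : Nonempty {A : Set (Param d) // MeasurableSet A} := ⟨⟨∅, MeasurableSet.empty⟩⟩
      exact ciSup_le fun S => hπt t S.1 S.2
    refine h1.trans (le_mul_of_one_le_right (by positivity) (by linarith))

end Existence

/-! ### Minorization -/

section Minorization

variable {d : ℕ}

theorem volume_preimage_sub_smul (θ : Param d) {β : ℝ} (hβ : 0 < β) (S : Set (Param d)) :
    volume {g : Param d | θ - β • g ∈ S} = ENNReal.ofReal (β ^ d)⁻¹ * volume S := by
  have e : {g : Param d | θ - β • g ∈ S}
      = (fun g => (-β) • g) ⁻¹' ((fun x => x + θ) ⁻¹' S) := by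
    ext g
    simp [sub_eq_add_neg, add_comm]
  rw [e, Measure.addHaar_preimage_smul _ (neg_ne_zero.2 hβ.ne'), measure_preimage_add_right,
    finrank_euclideanSpace_fin, abs_inv, abs_pow, abs_neg, abs_of_pos hβ]

/-- From a point where the threshold is at least `τ₀` and the gradient is at most `G`, one step
spreads over a ball of radius `β τ₀`. -/
theorem le_qcKernel_apply {ℒ : Param d → ℝ} {η β p τ₀ G w c : ℝ}
    {DO DI : Kernel (Param d) (Param d)} [IsMarkovKernel DO] [IsMarkovKernel DI]
    (hη : η < 1) (hβ : 0 < β)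
    {θ : Param d} (hτ : τ₀ ≤ threshold DI p θ) (hG : ‖gradient ℒ θ‖ ≤ G) (hw : 0 ≤ w) (hc : 0 ≤ c)
    {ν₁ ν₂ : Measure (Param d)} {h : Param d → ENNReal}
    (hmix : noiseLaw ℒ DI θ = ENNReal.ofReal w • ν₁ + ENNReal.ofReal (1 - w) • ν₂)
    (hν₁ : ν₁ = (volume : Measure (Param d)).withDensity h)
    (hlow : ENNReal.ofReal c ≤ ⨅ ω ∈ Metric.closedBall (0 : Param d) (τ₀ + G), h ω)
    {S : Set (Param d)} (hS : MeasurableSet S) (hSub : S ⊆ Metric.closedBall θ (β * τ₀)) :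
    ENNReal.ofReal ((1 - η) * (w * (c * (β ^ d)⁻¹))) * volume S ≤ qcKernel η DO DI β p θ S := by
  set v := gradient ℒ θ
  have hstep : Measurable (qcStep DI β p θ) :=
    (measurable_qcStep DI β p).comp measurable_prodMk_left
  set A : Set (Param d) := {g | θ - β • g ∈ S} with hA
  have hAm : MeasurableSet A := hS.preimage (by fun_prop)
  have hAτ : ∀ g ∈ A, ‖g‖ ≤ τ₀ := by
    intro g hg
    have h1 := mem_closedBall_iff_norm.1 (hSub hg)
    rw [sub_sub_cancel_left, norm_neg, norm_smul, Real.norm_of_nonneg hβ.le] at h1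
    exact le_of_mul_le_mul_left h1 hβ
  -- Landing within `β τ₀` without clipping forces `‖g‖ ≤ τ₀`, so these gradients are indeed not
  -- clipped.
  have hsubA : A ⊆ qcStep DI β p θ ⁻¹' S := by
    intro g hg
    rw [Set.mem_preimage, qcStep_eq, clip_eq_self ((hAτ g hg).trans hτ)]
    exact hg
  have hsubm : Measurable fun g : Param d => g - v := by fun_prop
  set E : Set (Param d) := (fun ε => ε + v) ⁻¹' A with hE
  have hEm : MeasurableSet E := hAm.preimage (by fun_prop)
  have h1 : noiseLaw ℒ DI θ E = DI θ A := by
    rw [noiseLaw, Measure.map_apply hsubm hEm]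
    congr 1
    ext g
    simp [hE, v]
  have h2 : ENNReal.ofReal c * volume E ≤ ν₁ E := by
    rw [hν₁, withDensity_apply _ hEm, ← setLIntegral_const]
    refine setLIntegral_mono' hEm fun ε hε => ?_
    refine hlow.trans (iInf₂_le ε ?_)
    have h3 := hAτ _ hε
    have h4 := norm_sub_le (ε + v) v
    rw [add_sub_cancel_right] at h4
    rw [mem_closedBall_zero_iff]
    linarith
  have h3 : volume E = ENNReal.ofReal (β ^ d)⁻¹ * volume S := by
    rw [hE, measure_preimage_add_right, hA, volume_preimage_sub_smul θ hβ]
  have h4 : qcKernel η DO DI β p θ S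
      = ENNReal.ofReal η * DO θ (qcStep DI β p θ ⁻¹' S)
        + ENNReal.ofReal (1 - η) * DI θ (qcStep DI β p θ ⁻¹' S) := by
    have e : qcKernel η DO DI β p θ
        = (ENNReal.ofReal η • DO θ + ENNReal.ofReal (1 - η) • DI θ).map (qcStep DI β p θ) := rfl
    rw [e, Measure.map_apply hstep hS]
    rfl
  calc _ = ENNReal.ofReal (1 - η) * (ENNReal.ofReal w * (ENNReal.ofReal c * volume E)) := by
        rw [h3, ENNReal.ofReal_mul (by linarith), ENNReal.ofReal_mul hw, ENNReal.ofReal_mul hc]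
        simp only [mul_assoc]
    _ ≤ ENNReal.ofReal (1 - η) * (ENNReal.ofReal w * ν₁ E) := by gcongr
    _ ≤ ENNReal.ofReal (1 - η) * noiseLaw ℒ DI θ E := by
        rw [hmix]
        simp only [Measure.add_apply, Measure.smul_apply, smul_eq_mul]
        gcongr
        exact le_self_add
    _ ≤ ENNReal.ofReal (1 - η) * DI θ (qcStep DI β p θ ⁻¹' S) := by
        rw [h1]; gcongr
    _ ≤ _ := by rw [h4]; exact le_add_self

theorem exists_point_towards (θs θ : Param d) {u : ℝ} (hu : 0 ≤ u) :
    ∃ y : Param d, ‖y - θ‖ ≤ u ∧ ‖y - θs‖ ≤ max (‖θ - θs‖ - u) 0 := by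
  by_cases h : ‖θ - θs‖ ≤ u
  · exact ⟨θs, by rwa [norm_sub_rev], by simp⟩
  have hpos : 0 < ‖θ - θs‖ := hu.trans_lt (not_le.1 h)
  refine ⟨θ - (u / ‖θ - θs‖) • (θ - θs), ?_, le_max_of_le_left ?_⟩
  · rw [sub_sub_cancel_left, norm_neg, norm_smul, Real.norm_of_nonneg (by positivity),
      div_mul_cancel₀ _ hpos.ne']
  · have e : θ - (u / ‖θ - θs‖) • (θ - θs) - θs = (1 - u / ‖θ - θs‖) • (θ - θs) := by
      rw [sub_smul, one_smul]; abel
    have h1 : u / ‖θ - θs‖ ≤ 1 := (div_le_one hpos).2 (not_le.1 h).le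
    rw [e, norm_smul, Real.norm_of_nonneg (by linarith), sub_mul, one_mul,
      div_mul_cancel₀ _ hpos.ne']

/-- A kernel which spreads over balls of a fixed radius around all points of a large ball is, in
several steps, minorized by a multiple of the volume of a small ball. -/
theorem exists_pow_minorization {P : Kernel (Param d) (Param d)} {θs : Param d} {r R c : ℝ}
    (hr : 0 < r) (hrR : r ≤ R) (hc : 0 < c)
    (hP : ∀ θ, ‖θ - θs‖ ≤ R → ∀ S, MeasurableSet S → S ⊆ Metric.closedBall θ r →
      ENNReal.ofReal c * volume S ≤ P θ S) (k : ℕ) :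
    ∃ c' : ℝ, 0 < c' ∧ ∀ θ, ‖θ - θs‖ ≤ R → ‖θ - θs‖ ≤ (k + 1) * (r / 2) →
      ∀ S, MeasurableSet S → S ⊆ Metric.closedBall θs (r / 2) →
        ENNReal.ofReal c' * volume S ≤ (P ^ (k + 1)) θ S := by
  induction k with
  | zero =>
    refine ⟨c, hc, fun θ hθR hθ S hS hSub => ?_⟩
    rw [zero_add, pow_one]
    refine hP θ hθR S hS (hSub.trans (Metric.closedBall_subset_closedBall' ?_))
    rw [dist_comm, dist_eq_norm]
    norm_num at hθ
    linarith
  | succ k ih =>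
    obtain ⟨c₁, hc₁, ih⟩ := ih
    have hvol : 0 < (volume : Measure (Param d)).real (Metric.closedBall 0 (r / 4)) :=
      ENNReal.toReal_pos (Metric.measure_closedBall_pos _ _ (by positivity)).ne'
        measure_closedBall_lt_top.ne
    set a := (volume : Measure (Param d)).real (Metric.closedBall 0 (r / 4)) with ha
    refine ⟨c₁ * (c * a), by positivity, fun θ hθR hθ S hS hSub => ?_⟩
    -- A ball of radius `r/4` around a point moved by `3r/4` stays within reach `r`, and each of its
    -- points is closer to `θs` by at least `r/2`, unless it is already within `r/4`.
    obtain ⟨y, hy1, hy2⟩ := exists_point_towards θs θ (u := 3 * r / 4) (by positivity)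
    have hvola : volume (Metric.closedBall y (r / 4)) = ENNReal.ofReal a := by
      rw [ha, ofReal_measureReal measure_closedBall_lt_top.ne, Measure.addHaar_closedBall_center]
    have hz : ∀ z ∈ Metric.closedBall y (r / 4),
        ENNReal.ofReal c₁ * volume S ≤ (P ^ (k + 1)) z S := by
      intro z hz
      have h1 := mem_closedBall_iff_norm.1 hz
      have h2 := norm_add_le (z - y) (y - θs)
      rw [sub_add_sub_cancel] at h2
      have h3 : ‖y - θs‖ + r / 4 ≤ R ∧ ‖y - θs‖ + r / 4 ≤ (k + 1) * (r / 2) := by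
        have h4 : 0 ≤ (k : ℝ) * (r / 2) := by positivity
        push_cast at hθ
        rcases le_max_iff.1 hy2 with h | h <;> constructor <;> linarith
      exact ih z (by linarith [h3.1]) (by linarith [h3.2]) S hS hSub
    have hball : ENNReal.ofReal c * ENNReal.ofReal a ≤ P θ (Metric.closedBall y (r / 4)) := by
      rw [← hvola]
      refine hP θ hθR _ Metric.isClosed_closedBall.measurableSet
        (Metric.closedBall_subset_closedBall' ?_)
      rw [dist_eq_norm]
      linarith
    calc _ = ENNReal.ofReal c₁ * volume S * (ENNReal.ofReal c * ENNReal.ofReal a) := by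
          rw [ENNReal.ofReal_mul hc₁.le, ENNReal.ofReal_mul hc.le]; ring
      _ ≤ ENNReal.ofReal c₁ * volume S * P θ (Metric.closedBall y (r / 4)) := by gcongr
      _ = ∫⁻ _ in Metric.closedBall y (r / 4), ENNReal.ofReal c₁ * volume S ∂(P θ) := by
          rw [setLIntegral_const]
      _ ≤ ∫⁻ z in Metric.closedBall y (r / 4), (P ^ (k + 1)) z S ∂(P θ) :=
          setLIntegral_mono' Metric.isClosed_closedBall.measurableSet hz
      _ ≤ ∫⁻ z, (P ^ (k + 1)) z S ∂(P θ) := setLIntegral_le_lintegral _ _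
      _ = (P ^ (k + 1 + 1)) θ S := by
          have := Kernel.pow_add_apply_eq_lintegral P 1 (k + 1) θ hS
          rw [pow_one] at this
          rw [← this, add_comm 1]

/-- Each step gains `r/2`, so about `2R/r` steps reach `θs` from the whole ball; the minorizing law
is uniform on the ball of radius `r/2` around `θs`. -/
theorem exists_minorization {P : Kernel (Param d) (Param d)} {θs : Param d} {r R c : ℝ}
    (hr : 0 < r) (hrR : r ≤ R) (hc : 0 < c)
    (hP : ∀ θ, ‖θ - θs‖ ≤ R → ∀ S, MeasurableSet S → S ⊆ Metric.closedBall θ r →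
      ENNReal.ofReal c * volume S ≤ P θ S) :
    ∃ (m : ℕ) (α : ℝ) (ν : Measure (Param d)), 0 < m ∧ 0 < α ∧ IsProbabilityMeasure ν ∧
      ∀ θ, ‖θ - θs‖ ≤ R → ENNReal.ofReal α • ν ≤ (P ^ m) θ := by
  obtain ⟨k, hk⟩ := exists_nat_ge (R / (r / 2))
  obtain ⟨c', hc', h⟩ := exists_pow_minorization hr hrR hc hP k
  set U := Metric.closedBall θs (r / 2) with hU
  have hUm : MeasurableSet U := Metric.isClosed_closedBall.measurableSet
  have hU0 : volume U ≠ 0 := (Metric.measure_closedBall_pos _ _ (by positivity)).ne'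
  have hUt : volume U ≠ ⊤ := measure_closedBall_lt_top.ne
  have hUr : 0 < (volume : Measure (Param d)).real U := ENNReal.toReal_pos hU0 hUt
  refine ⟨k + 1, c' * (volume : Measure (Param d)).real U, cond volume U, k.succ_pos,
    by positivity, cond_isProbabilityMeasure_of_finite hU0 hUt, fun θ hθ => ?_⟩
  refine Measure.le_iff.2 fun S hS => ?_
  rw [Measure.smul_apply, cond_apply hUm, smul_eq_mul, ENNReal.ofReal_mul hc'.le,
    ofReal_measureReal hUt, mul_assoc, ← mul_assoc (volume U), ENNReal.mul_inv_cancel hU0 hUt,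
    one_mul]
  refine (h θ hθ ?_ (U ∩ S) (hUm.inter hS) Set.inter_subset_left).trans
    (measure_mono Set.inter_subset_right)
  have := (div_le_iff₀ (by positivity : 0 < r / 2)).1 hk
  linarith

end Minorization

/-- Existence and uniqueness of the limit law of the clipped chain, with geometric convergence. -/
theorem exists_geometricConvergence_qcKernel {d : ℕ}
    {ℒ : Param d → ℝ} {L μ : ℝ} (hsmooth : LipschitzSmooth ℒ L) (hconv : StronglyConvex ℒ μ)
    {θs : Param d} (hθs : ∀ θ, ℒ θs ≤ ℒ θ) {η β p γ b : ℝ} (hη0 : 0 ≤ η) (hη1 : η < 1)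
    (hβ : 0 < β) {DO DI : Kernel (Param d) (Param d)} [IsMarkovKernel DO] [IsMarkovKernel DI]
    (hnoise : CenteredDiffuseNoise ℒ DI) (hP : Drift (qcKernel η DO DI β p) θs γ b)
    (hγ0 : 0 < γ) (hγ1 : γ ≤ 1) (hb : 0 < b)
    (hthr : ∀ R : ℝ, ∃ τ₀ : ℝ, 0 < τ₀ ∧ ∀ θ : Param d, ‖θ‖ ≤ R → τ₀ ≤ threshold DI p θ)
    (θ₀ : Param d) :
    ∃ π : Measure (Param d),
      (∀ π' : Measure (Param d), IsProbabilityMeasure π' →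
        Kernel.Invariant (qcKernel η DO DI β p) π' → π' = π) ∧
      ∃ M ρ : ℝ, GeometricConvergence (qcKernel η DO DI β p) θs θ₀ π M ρ := by
  have := isMarkovKernel_qcKernel hη0 hη1.le DO DI β p
  set R := √(4 * (b / γ) / γ) with hR
  have hR0 : 0 < R := Real.sqrt_pos.2 (by positivity)
  obtain ⟨τ₁, hτ₁, hthr⟩ := hthr (R + ‖θs‖)
  obtain ⟨w, ϰ, hw, hw1, hϰ, hmix⟩ := hnoise.2
  -- The cap `R / β` keeps the spreading radius `β τ₀` at most `R`.
  set τ₀ := min τ₁ (R / β) with hτ₀def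
  have hτ₀ : 0 < τ₀ := lt_min hτ₁ (by positivity)
  -- `|L|` rather than `L`: in dimension zero the sign of `L` is not determined.
  have hGpos : 0 < τ₀ + |L| * R := by positivity
  have hc := hϰ _ hGpos
  have h1η : 0 < 1 - η := by linarith
  obtain ⟨m, α, ν, hm, hα, hν, hmin⟩ := exists_minorization (P := qcKernel η DO DI β p)
    (θs := θs) (r := β * τ₀) (R := R)
    (c := (1 - η) * (w * (ϰ (τ₀ + |L| * R) * (β ^ d)⁻¹))) (by positivity)
    (by
      calc β * τ₀ ≤ β * (R / β) := by gcongr; exact min_le_right _ _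
        _ = R := by field_simp)
    (by positivity) (fun θ hθ S hS hSub => by
      obtain ⟨ν₁, ν₂, h, -, -, hmixθ, -, hν₁, hlow⟩ := hmix θ
      refine le_qcKernel_apply hη1 hβ ((min_le_left _ _).trans (hthr θ ?_)) ?_ hw.le hc.le
        hmixθ hν₁ (hlow _ hGpos).le hS hSub
      · have := norm_add_le (θ - θs) θs
        rw [sub_add_cancel] at this
        linarith
      · refine (norm_gradient_le hsmooth hconv hθs θ).trans ?_
        gcongr
        exact le_abs_self L)
  exact hP.exists_geometricConvergence hγ0 hγ1 hb hm hα (ν := ν)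
    (fun x hx => hmin x (Real.le_sqrt_of_sq_le hx)) θ₀

end QCSGD

theorem corollary5 {d : ℕ}
    (ℒ : Param d → ℝ) (L μ : ℝ) (hsmooth : LipschitzSmooth ℒ L) (hconv : StronglyConvex ℒ μ)
    (θs : Param d) (hθs : ∀ θ, ℒ θs ≤ ℒ θ)
    (η : ℝ) (hη0 : 0 < η) (hη : η < 1 / 2)
    (DO DI : Kernel (Param d) (Param d)) [IsMarkovKernel DO] [IsMarkovKernel DI]
    (hnoise : CenteredDiffuseNoise ℒ DI)
    (q A B : ℝ) (hq : 2 ≤ q) (hA : 0 < A) (hB : 0 < B) (hmom : NoiseMomentBound ℒ DI θs q A B)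
    (p : ℝ) (hp : p = 1 - η) (κ : ℝ) (hκdef : κ = kappa η p μ L q A) (hκ : 0 < κ)
    (β : ℝ) (hβ0 : 0 < β)
    (hβ : β < 1 / 4 * (κ / (μ ^ 2 + 6 * L ^ 2 + 16 * η ^ (-(2 / q)) * A ^ 2)))
    (hβ' : β ≤ η ^ (2 - 2 / q) / κ)
    (θ₀ : Param d) :
    -- existence of the limit law and of the constants `M`, `ρ`, unless the thresholds degenerate
    ((∀ R : ℝ, ∃ τ₀ : ℝ, 0 < τ₀ ∧ ∀ θ : Param d, ‖θ‖ ≤ R → τ₀ ≤ threshold DI p θ) →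
      ∃ π : Measure (Param d),
        (∀ π' : Measure (Param d), IsProbabilityMeasure π' →
          Kernel.Invariant (qcKernel η DO DI β p) π' → π' = π) ∧
        ∃ M ρ : ℝ, GeometricConvergence (qcKernel η DO DI β p) θs θ₀ π M ρ) ∧
    -- the high-probability bound, for all such constants
    ∀ (π : Measure (Param d)) (M ρ : ℝ),
      GeometricConvergence (qcKernel η DO DI β p) θs θ₀ π M ρ →
      ∀ (δ : ℝ), 0 < δ →
      ∀ (N : ℕ) (hN : 0 < N), 16 * Real.log (1 / δ) ≤ N →
      ∀ (T : ℕ),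
        N * ⌈Real.log (15 * M * (1 + ‖θ₀ - θs‖ ^ 2)) / Real.log (1 / ρ)⌉₊ ≤ T →
      ∀ {Ω : Type*} [MeasurableSpace Ω] (Pr : Measure Ω) [IsProbabilityMeasure Pr]
        (g : ℕ → Ω → Param d), IsCorruptedStream Pr η DO DI β p θ₀ N hN g →
        1 - δ ≤ Pr.real {ω | ∀ θhat : Param d,
          IsAggregate hN (cyclicIterates N (qcStep DI β p) θ₀ (fun t => g t ω) T) θhat →
            ‖θhat - θs‖ ≤ 27 * η ^ (1 - 1 / q) * B / κ} := by
  subst hp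
  have hbκ : 0 < β * κ := mul_pos hβ0 hκ
  have hbκ' := mul_kappa_le hη0 hη hconv.2.1 hA hκdef hκ hβ
  set a := η ^ (1 - 1 / q) * B / κ with ha
  have ha0 : 0 < a := by positivity
  have hP : Drift (qcKernel η DO DI β (1 - η)) θs (9 / 10 * (β * κ)) (10 * (β * κ) * a ^ 2) :=
    lintegral_qcKernel_le hsmooth hconv hθs hη0 hη hnoise hq hA hB hmom hκdef hκ hβ0 hβ hβ'
  have hγ0 : 0 < 9 / 10 * (β * κ) := by positivity
  have hγ1 : 9 / 10 * (β * κ) ≤ 1 := by linarith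
  have hb : 0 < 10 * (β * κ) * a ^ 2 := by positivity
  refine ⟨fun hthr => exists_geometricConvergence_qcKernel hsmooth hconv hθs hη0.le
    (by linarith) hβ0 hnoise hP hγ0 hγ1 hb hthr θ₀, ?_⟩
  intro π M ρ hπ δ hδ N hN hNδ T hT Ω _ Pr _ g hg
  have hr : 27 * η ^ (1 - 1 / q) * B / κ = 3 * (9 * a) := by rw [ha]; ring
  rw [hr]
  refine hg.le_measure_aggregate hη0.le (by linarith) hP hγ0 hγ1 hb.le (by positivity) ?_ hπ hδ
    hNδ hT
  -- The radius `9a` makes the stationary tail `(100/9) / 81`, just below the `14/100` left once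
  -- `1/15` is set aside for convergence.
  have e : 10 * (β * κ) * a ^ 2 / (9 / 10 * (β * κ)) / (9 * a) ^ 2 = 100 / 729 := by
    field_simp
    norm_num
  rw [e]
  norm_num
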